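/- **Setting.** Let $1\le m\le L$ be integers, and for each sensor $\ell\in[L]=\{1,\dots,L\}$ let $g_\ell$ and $f_\ell$ be probability density functions on $\mathbb R$ (non-anomalous and anomalous) that define different distributions. Let $\mathcal E$ be the set of all $m$-element subsets of $[L]$ and $\mathcal A$ the set of all probability mass functions $\alpha=(\alpha_E)_{E\in\mathcal E}$ on $\mathcal E$. For $x\in\mathbb R^L$ put $$g(x)=\prod_{\ell=1}^L g_\ell(x_\ell),\qquad p_E(x)=\prod_{\ell\in E}f_\ell(x_\ell)\prod_{\ell\notin E}g_\ell(x_\ell),\qquad \overline p_\alpha(x)=\sum_{E\in\mathcal E}\alpha_E\,p_E(x),$$ and let $I_\alpha=\mathbb E_{\overline p_\alpha}\left[\log\frac{\overline p_\alpha(X)}{g(X)}\right]$ be the Kullback–Leibler number. Assume that $I_\alpha<\infty$ for every $\alpha\in\mathcal A$. The observation vectors $X[1],X[2],\dots$ in $\mathbb R^L$ are independent. For a changepoint $\nu\in\{0,1,2,\dots\}$ and a deterministic anomaly path $S=(S[k])_{k\ge1}$ in $\mathcal E$, under $\mathbb P^S_\nu$ the vector $X[k]$ has density $g$ for $k\le\nu$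 and $p_{S[k]}$ for $k>\nu$; under $\mathbb P_\infty$ every $X[k]$ has density $g$. Let $\mathscr F_k=\sigma(X[1],\dots,X[k])$. For a stopping time $\tau$ of this filtration with values in $\{1,2,\dots\}\cup\{\infty\}$, the mean time to false alarm is $\mathbb E_\infty[\tau]$ and the worst-path worst average detection delay is $$\mathrm{WADD}(\tau)=\sup_S\,\sup_{\nu\ge0}\,\operatorname{ess\,sup}\,\mathbb E^S_\nu\left[\tau-\nu\mid\tau>\nu,\mathscr F_\nu\right],$$ where the conditional expectation is read as $1$ if $\mathbb P^S_\nu(\tau>\nu)=0$. For $\gamma>1$ let $\mathcal C_\gamma$ be the class of all such $\tau$ with $\mathbb E_\infty[\tau]\ge\gamma$. For $\lambda\in\mathcal A$ and $b>0$ the M-CUSUM test is $$\tau_W(\lambda,b)=\inf\{k\ge1: W_\lambda[k]\ge e^b\},\qquad W_\lambda[k]=\max_{1\le i\le k}\ \prod_{j=i}^k\frac{\overline p_\lambda(X[j])}{g(X[j])}.$$ **Theorem.** Let $\alpha^*\in\mathcal A$ be a minimizer of $I_\alpha$ over $\alpha\in\mathcal A$, and assume that $$\max_{E\in\mathcal E}\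 \mathbb E_{p_E}\left[\left(\log\frac{\overline p_{\alpha^*}(X)}{g(X)}\right)^2\right]<\infty.$$ Then: i) for every $\gamma>1$, $\mathbb E_\infty[\tau_W(\alpha^*,\log\gamma)]\ge\gamma$; ii) as $\gamma\to\infty$, $$\inf_{\tau\in\mathcal C_\gamma}\mathrm{WADD}(\tau)\ \sim\ \mathrm{WADD}(\tau_W(\alpha^*,\log\gamma))\ \sim\ \frac{\log\gamma}{I_{\alpha^*}}$$ (for all large $\gamma$ both delays are finite; $u(\gamma)\sim v(\gamma)$ means that $u(\gamma)=v(\gamma)(1+o(1))$). -/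

import Mathlib

open MeasureTheory ProbabilityTheory Filter Topology Asymptotics
open scoped ENNReal NNReal

namespace MovingAnomaly

/-- `f` is a probability density function on the real line. -/
def IsPdf (f : ℝ → ℝ≥0) : Prop :=
  Measurable f ∧ ∫⁻ x, (f x : ℝ≥0∞) = 1

/-- The possible anomaly placements: sets of exactly `m` of the `L` sensors. -/
abbrev Placement (L m : ℕ) : Type := {E : Finset (Fin L) // E.card = m}

/-- The sample space of observation sequences. The sequence `X[1], X[2], …` of observation vectors
is indexed from `0`: the coordinate `ω j` is the observation vector `X[j + 1]`. -/
abbrev Obs (L : ℕ) : Type := ℕ → (Fin L → ℝ)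

/-- The anomaly paths: `S j` is the placement of the anomaly at time `j + 1`. -/
abbrev AnomalyPath (L m : ℕ) : Type := ℕ → Placement L m

section Densities

variable {L m : ℕ}

/-- The joint density `p_E` of one observation vector when exactly the sensors in `E` are anomalous.
The choice `E = ∅` gives the density before the change. -/
noncomputable def jointDensity (f g : Fin L → ℝ → ℝ≥0) (E : Finset (Fin L))
    (x : Fin L → ℝ) : ℝ≥0∞ :=
  (∏ l ∈ E, (f l (x l) : ℝ≥0∞)) * ∏ l ∈ Eᶜ, (g l (x l) : ℝ≥0∞)

/-- The density `g` of one observation vector before the change. -/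
noncomputable def preDensity (g : Fin L → ℝ → ℝ≥0) (x : Fin L → ℝ) : ℝ≥0∞ :=
  ∏ l, (g l (x l) : ℝ≥0∞)

/-- The mixture density `∑ E, α E * p_E` for a probability mass function `α` on the placements. -/
noncomputable def mixDensity (f g : Fin L → ℝ → ℝ≥0) (α : PMF (Placement L m))
    (x : Fin L → ℝ) : ℝ≥0∞ :=
  ∑ E : Placement L m, α E * jointDensity f g E.1 x

/-- The law of one observation vector when exactly the sensors in `E` are anomalous. -/
noncomputable def jointLaw (f g : Fin L → ℝ → ℝ≥0) (E : Finset (Fin L)) :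
    Measure (Fin L → ℝ) :=
  volume.withDensity (jointDensity f g E)

/-- The law of one observation vector before the change. -/
noncomputable def preLaw (g : Fin L → ℝ → ℝ≥0) : Measure (Fin L → ℝ) :=
  volume.withDensity (preDensity g)

/-- The law of one observation vector when the placement is drawn at random from `α`. -/
noncomputable def mixLaw (f g : Fin L → ℝ → ℝ≥0) (α : PMF (Placement L m)) :
    Measure (Fin L → ℝ) :=
  volume.withDensity (mixDensity f g α)

/-- The likelihood ratio of the mixture density to the density before the change. -/
noncomputable def mixRatio (f g : Fin L → ℝ → ℝ≥0) (α : PMF (Placement L m))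
    (x : Fin L → ℝ) : ℝ≥0∞ :=
  mixDensity f g α x / preDensity g x

/-- The Kullback-Leibler number `I_α`: the expected log-likelihood ratio of the mixture density to
the density before the change, under the mixture; it is `∞` when this expectation is infinite. -/
noncomputable def klNumber (f g : Fin L → ℝ → ℝ≥0) (α : PMF (Placement L m)) : ℝ≥0∞ :=
  InformationTheory.klDiv (mixLaw f g α) (preLaw g)

/-- The second moment, when the anomaly is at `E`, of the mixture log-likelihood ratio. The
logarithm takes values in the extended reals. -/
noncomputable def secondMoment (f g : Fin L → ℝ → ℝ≥0) (α : PMF (Placement L m))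
    (E : Placement L m) : ℝ≥0∞ :=
  ∫⁻ x, (ENNReal.log (mixRatio f g α x)).abs ^ 2 ∂(jointLaw f g E.1)

end Densities

section Model

variable {L m : ℕ}

/-- The law `P_ν^S` of the observations: independent over time, without anomaly at the times
`1, …, ν`, and with anomaly placement `S[k]` at each time `k > ν`. -/
noncomputable def pathLaw (f g : Fin L → ℝ → ℝ≥0) (ν : ℕ) (S : AnomalyPath L m) :
    Measure (Obs L) :=
  Measure.infinitePi fun j => if j < ν then preLaw g else jointLaw f g (S j).1

/-- The law `P_∞` of the observations when no anomaly ever appears. -/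
noncomputable def noChangeLaw (g : Fin L → ℝ → ℝ≥0) : Measure (Obs L) :=
  Measure.infinitePi fun _ => preLaw g

/-- The filtration of the observations: the `k`-th σ-algebra is generated by `X[1], …, X[k]`. -/
def obsFiltration (L : ℕ) :
    Filtration ℕ (inferInstance : MeasurableSpace (Obs L)) where
  seq k := ⨆ (j : ℕ) (_ : j < k), MeasurableSpace.comap (fun ω : Obs L => ω j) inferInstance
  mono' _ _ h := iSup₂_le fun j hj =>
    le_iSup₂ (f := fun (j : ℕ) _ => MeasurableSpace.comap (fun ω : Obs L => ω j) inferInstance)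
      j (lt_of_lt_of_le hj h)
  le' _ := iSup₂_le fun j _ => (measurable_pi_apply j).comap_le

/-- Positive, possibly infinite, stopping times of the observation filtration. -/
def IsDetectionTime (τ : Obs L → ℕ∞) : Prop :=
  IsStoppingTime (obsFiltration L) τ ∧ ∀ ω, 1 ≤ τ ω

/-- The mean time to false alarm `E_∞[τ]`. -/
noncomputable def mtfa (g : Fin L → ℝ → ℝ≥0) (τ : Obs L → ℕ∞) : ℝ≥0∞ :=
  ∫⁻ ω, (τ ω : ℝ≥0∞) ∂(noChangeLaw g)

open Classical in
/-- `ess sup E_ν^S[τ - ν | τ > ν, F_ν]`, which is `1` by convention if `τ > ν` has probability `0`.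
The conditional expectation is the one of the measure conditioned on the event `τ > ν`. -/
noncomputable def worstDelay (f g : Fin L → ℝ → ℝ≥0) (τ : Obs L → ℕ∞) (ν : ℕ)
    (S : AnomalyPath L m) : ℝ≥0∞ :=
  if pathLaw f g ν S {ω | (ν : ℕ∞) < τ ω} = 0 then 1
  else
    essSup
      (condLExp (obsFiltration L ν) ((pathLaw f g ν S)[|{ω | (ν : ℕ∞) < τ ω}])
        fun ω => (τ ω : ℝ≥0∞) - ν)
      ((pathLaw f g ν S)[|{ω | (ν : ℕ∞) < τ ω}])

/-- The worst-path worst average detection delay, for anomalies of size `m`. -/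
noncomputable def wadd (m : ℕ) (f g : Fin L → ℝ → ℝ≥0) (τ : Obs L → ℕ∞) : ℝ≥0∞ :=
  ⨆ (S : AnomalyPath L m) (ν : ℕ), worstDelay f g τ ν S

/-- The class `C_γ` of the stopping times whose mean time to false alarm is at least `γ`. -/
def stoppingClass (g : Fin L → ℝ → ℝ≥0) (γ : ℝ) : Set (Obs L → ℕ∞) :=
  {τ | IsDetectionTime τ ∧ ENNReal.ofReal γ ≤ mtfa g τ}

/-- The optimal worst-path delay over the class `C_γ`. -/
noncomputable def optWadd (m : ℕ) (f g : Fin L → ℝ → ℝ≥0) (γ : ℝ) : ℝ≥0∞ :=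
  ⨅ τ ∈ stoppingClass g γ, wadd m f g τ

/-- The M-CUSUM statistic `W[k]`: the maximum over `1 ≤ i ≤ k` of the product of the mixture
likelihood ratios at the times `i, …, k`; here `W[0] = 0`. The index `i` below is shifted by one. -/
noncomputable def mCusumStat (f g : Fin L → ℝ → ℝ≥0) (α : PMF (Placement L m)) (k : ℕ)
    (ω : Obs L) : ℝ≥0∞ :=
  (Finset.range k).sup fun i => ∏ j ∈ Finset.Ico i k, mixRatio f g α (ω j)

/-- The M-CUSUM stopping time: the first time `k ≥ 1` at which `W[k] ≥ exp b`, and `∞` if there is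
no such time. -/
noncomputable def mCusumTime (f g : Fin L → ℝ → ℝ≥0) (α : PMF (Placement L m)) (b : ℝ)
    (ω : Obs L) : ℕ∞ :=
  ⨅ (k : ℕ) (_ : 1 ≤ k ∧ ENNReal.ofReal (Real.exp b) ≤ mCusumStat f g α k ω), (k : ℕ∞)

end Model

end MovingAnomaly

open MovingAnomaly

/-! The problem behaves like a game between the detector and the choice of path, with `αs` as the
least favourable way of drawing placements.

False alarms: under the no-change law the Shiryaev–Roberts statistic minus `k` is a martingale, and
it dominates the M-CUSUM statistic. Stopping at level `γ` therefore takes at least `γ` steps on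
average (`le_lintegral_of_le_shiryaevRoberts`).

Upper bound on the delay: comparing `αs` with mixtures that put a small mass `ε` on a placement `E`
gives the first-order condition that the mixture log-ratio has mean at least `I = I_αs` under every
`p_E` (`klNumber_le_integral_log`). Along any path the log-likelihood walk started at the
changepoint thus has drift at least `I`. A Wald-type argument with a quadratic correction of the
increments, which needs only bounded second moments, bounds the mean crossing time of `b = log γ` by
`(b + c) / (I - M / (4 * c))` (`tsum_measure_walkBelow_le`). The walk does not depend on the past,
so the bound is uniform in the conditioning (`wadd_mCusumTime_le`).

Lower bound on the delay: the worst path is at least as bad as a random one. With placements drawn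
independently from `α`, the observations after the change are i.i.d. with the mixture density, which
reduces the claim to a classical changepoint problem with known densities
(`sum_setLIntegral_prod_mixRatio_le`). There, a mean time to false alarm of `γ` forces some `ν` at
which stopping in the next `h` steps is rare under the no-change law (`exists_sum_measure_eq_le`). A
stopping rule that nevertheless reacts to the change must have gathered about `log (γ / (2 * h))` of
relative entropy, which arrives at rate `I_α` per step (`sub_mul_log_le`). The bound holds for every
`α`, and `αs` makes it match the upper bound.

Taking `c = √b` and `h` of order `b ^ 2` makes all corrections negligible against `b = log γ`. -/

namespace MovingAnomaly

/-! ### Independence and change of measure for infinite product laws -/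

section ProductLaws

variable {L : ℕ}

theorem measurable_coord_past {j k : ℕ} (h : j < k) :
    Measurable[obsFiltration L k] (fun ω : Obs L => ω j) := by
  rw [measurable_iff_comap_le]
  exact le_iSup₂ (f := fun (j : ℕ) _ =>
    MeasurableSpace.comap (fun ω : Obs L => ω j) inferInstance) j h

/-- The σ-algebra generated by the observations `X[k+1], X[k+2], …`. -/
abbrev futureSigma (L k : ℕ) : MeasurableSpace (Obs L) :=
  ⨆ j ∈ {j : ℕ | k ≤ j}, MeasurableSpace.comap (fun ω : Obs L => ω j) inferInstance

theorem futureSigma_le (k : ℕ) : futureSigma L k ≤ (inferInstance : MeasurableSpace (Obs L)) :=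
  iSup₂_le fun j _ => (measurable_pi_apply j).comap_le

theorem measurable_coord_future {j k : ℕ} (h : k ≤ j) :
    Measurable[futureSigma L k] (fun ω : Obs L => ω j) := by
  rw [measurable_iff_comap_le]
  exact le_iSup₂ (f := fun (j : ℕ) (_ : j ∈ {j : ℕ | k ≤ j}) =>
    MeasurableSpace.comap (fun ω : Obs L => ω j) inferInstance) j h

variable (μ : ℕ → Measure (Fin L → ℝ)) [∀ j, IsProbabilityMeasure (μ j)]

theorem indep_past_future (k : ℕ) :
    Indep (obsFiltration L k) (futureSigma L k) (Measure.infinitePi μ) := by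
  have h := iIndepFun_infinitePi (P := μ) (X := fun _ x => x) (fun _ => measurable_id)
  have h2 := indep_iSup_of_disjoint (fun j => (measurable_pi_apply j).comap_le) h.iIndep
    (S := {j | j < k}) (T := {j | k ≤ j})
    (Set.disjoint_left.2 fun a (ha : a < k) (hb : k ≤ a) => by omega)
  exact h2

theorem lintegral_past_mul_future (k : ℕ) {u v : Obs L → ℝ≥0∞}
    (hu : Measurable[obsFiltration L k] u) (hv : Measurable[futureSigma L k] v) :
    ∫⁻ ω, u ω * v ω ∂(Measure.infinitePi μ) =
      (∫⁻ ω, u ω ∂(Measure.infinitePi μ)) * ∫⁻ ω, v ω ∂(Measure.infinitePi μ) :=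
  lintegral_mul_eq_lintegral_mul_lintegral_of_independent_measurableSpace
    ((obsFiltration L).le k) (futureSigma_le k) (indep_past_future μ k) hu hv

theorem lintegral_coord (k : ℕ) {v : (Fin L → ℝ) → ℝ≥0∞} (hv : Measurable v) :
    ∫⁻ ω, v (ω k) ∂(Measure.infinitePi μ) = ∫⁻ x, v x ∂(μ k) := by
  rw [← (measurePreserving_eval_infinitePi μ k).lintegral_comp hv]

theorem lintegral_past_mul_coord (k : ℕ) {u : Obs L → ℝ≥0∞} {v : (Fin L → ℝ) → ℝ≥0∞}
    (hu : Measurable[obsFiltration L k] u) (hv : Measurable v) :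
    ∫⁻ ω, u ω * v (ω k) ∂(Measure.infinitePi μ) =
      (∫⁻ ω, u ω ∂(Measure.infinitePi μ)) * ∫⁻ x, v x ∂(μ k) := by
  rw [lintegral_past_mul_future μ k hu (v := fun ω => v (ω k))
    (hv.comp (measurable_coord_future le_rfl)), lintegral_coord μ k hv]

theorem indepFun_past_coord (k : ℕ) {u : Obs L → ℝ} {v : (Fin L → ℝ) → ℝ}
    (hu : Measurable[obsFiltration L k] u) (hv : Measurable v) :
    IndepFun u (fun ω : Obs L => v (ω k)) (Measure.infinitePi μ) := by
  rw [IndepFun_iff_Indep]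
  have h2 : Measurable[futureSigma L k] fun ω : Obs L => v (ω k) :=
    hv.comp (measurable_coord_future le_rfl)
  exact indep_of_indep_of_le_left (indep_of_indep_of_le_right (indep_past_future μ k)
    h2.comap_le) hu.comap_le

theorem integrable_coord (k : ℕ) {v : (Fin L → ℝ) → ℝ} (hvi : Integrable v (μ k)) :
    Integrable (fun ω : Obs L => v (ω k)) (Measure.infinitePi μ) :=
  (measurePreserving_eval_infinitePi μ k).integrable_comp_of_integrable hvi

theorem integral_coord (k : ℕ) {v : (Fin L → ℝ) → ℝ} (hv : Measurable v) :
    ∫ ω, v (ω k) ∂(Measure.infinitePi μ) = ∫ x, v x ∂(μ k) := by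
  rw [← (measurePreserving_eval_infinitePi μ k).map_eq, integral_map]
  · exact (measurable_pi_apply k).aemeasurable
  · exact hv.aestronglyMeasurable

theorem integrable_past_mul_coord (k : ℕ) {u : Obs L → ℝ} {v : (Fin L → ℝ) → ℝ}
    (hu : Measurable[obsFiltration L k] u) (hv : Measurable v)
    (hui : Integrable u (Measure.infinitePi μ)) (hvi : Integrable v (μ k)) :
    Integrable (fun ω => u ω * v (ω k)) (Measure.infinitePi μ) :=
  (indepFun_past_coord μ k hu hv).integrable_mul hui (integrable_coord μ k hvi)

theorem integral_past_mul_coord (k : ℕ) {u : Obs L → ℝ} {v : (Fin L → ℝ) → ℝ}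
    (hu : Measurable[obsFiltration L k] u) (hv : Measurable v) :
    ∫ ω, u ω * v (ω k) ∂(Measure.infinitePi μ) =
      (∫ ω, u ω ∂(Measure.infinitePi μ)) * ∫ x, v x ∂(μ k) := by
  rw [(indepFun_past_coord μ k hu hv).integral_fun_mul_eq_mul_integral
    (hu.mono ((obsFiltration L).le k) le_rfl).aestronglyMeasurable
    (hv.comp (measurable_pi_apply k)).aestronglyMeasurable, integral_coord μ k hv]

theorem past_le_comap_restrict (k : ℕ) :
    (obsFiltration L k : MeasurableSpace (Obs L)) ≤
      MeasurableSpace.comap (Finset.restrict (π := fun _ : ℕ => Fin L → ℝ) (Finset.range k))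
        inferInstance := by
  refine iSup₂_le fun j hj => ?_
  rw [← measurable_iff_comap_le]
  exact (measurable_pi_apply (X := fun _ : Finset.range k => Fin L → ℝ)
    ⟨j, Finset.mem_range.2 hj⟩).comp
    (comap_measurable _)

/-- An event of the past sees only finitely many coordinates, so the remaining factors may be
replaced at will. This removes the infinitely many post-change factors, for which no density with
respect to the no-change law need exist. -/
theorem infinitePi_apply_congr_past {μ' : ℕ → Measure (Fin L → ℝ)}
    [∀ j, IsProbabilityMeasure (μ' j)] {k : ℕ} (h : ∀ j < k, μ j = μ' j) {B : Set (Obs L)}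
    (hB : MeasurableSet[obsFiltration L k] B) :
    Measure.infinitePi μ B = Measure.infinitePi μ' B := by
  obtain ⟨C, hC, rfl⟩ := past_le_comap_restrict k B hB
  rw [← Measure.map_apply (by fun_prop) hC, ← Measure.map_apply (by fun_prop) hC,
    Measure.infinitePi_map_restrict, Measure.infinitePi_map_restrict]
  congr 2
  ext1 i
  exact h i (Finset.mem_range.1 i.2)

theorem lintegral_prod_coord (s : Finset ℕ) {v : ℕ → (Fin L → ℝ) → ℝ≥0∞}
    (hv : ∀ j, Measurable (v j)) :
    ∫⁻ ω, ∏ j ∈ s, v j (ω j) ∂(Measure.infinitePi μ) = ∏ j ∈ s, ∫⁻ x, v j x ∂(μ j) := by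
  rw [lintegral_prod_eq_prod_lintegral_of_indepFun s (fun j (ω : Obs L) => v j (ω j))
    (iIndepFun_infinitePi (P := μ) hv) (fun j => (hv j).comp (measurable_pi_apply j))]
  exact Finset.prod_congr rfl fun j _ => lintegral_coord μ j (hv j)

/-- A product law is determined by finite-dimensional boxes, and on a box the integral of the
density factorizes over the coordinates. -/
theorem infinitePi_withDensity_prod (J : Finset ℕ) {v : ℕ → (Fin L → ℝ) → ℝ≥0∞}
    (hv : ∀ j, Measurable (v j)) {μ' : ℕ → Measure (Fin L → ℝ)}
    [∀ j, IsProbabilityMeasure (μ' j)] (hJ : ∀ j ∈ J, μ' j = (μ j).withDensity (v j))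
    (hJc : ∀ j ∉ J, μ' j = μ j) :
    Measure.infinitePi μ' =
      (Measure.infinitePi μ).withDensity (fun ω => ∏ j ∈ J, v j (ω j)) := by
  symm
  refine Measure.eq_infinitePi _ fun s t ht => ?_
  have hs : MeasurableSet ((s : Set ℕ).pi t) :=
    MeasurableSet.pi s.countable_toSet fun j _ => ht j
  classical
  -- Each coordinate factor carries both its share of the density and its side of the box, so the
  -- integrand becomes a single product over `J ∪ s`.
  set w : ℕ → (Fin L → ℝ) → ℝ≥0∞ := fun j x =>
    (if j ∈ J then v j x else 1) * (if j ∈ s then (t j).indicator 1 x else 1) with hw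
  have hwm : ∀ j, Measurable (w j) := fun j => by
    refine Measurable.mul ?_ ?_
    · split_ifs
      · exact hv j
      · exact measurable_const
    · split_ifs
      · exact measurable_one.indicator (ht j)
      · exact measurable_const
  have h1 : ∀ ω : Obs L, ((s : Set ℕ).pi t).indicator (fun ω => ∏ j ∈ J, v j (ω j)) ω =
      ∏ j ∈ J ∪ s, w j (ω j) := fun ω => by
    rw [hw, Finset.prod_mul_distrib, Finset.prod_ite_mem, Finset.prod_ite_mem,
      Finset.union_inter_cancel_left, Finset.union_inter_cancel_right]
    by_cases h : ω ∈ (s : Set ℕ).pi t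
    · rw [Set.indicator_of_mem h, Finset.prod_congr rfl
        (fun j hj => Set.indicator_of_mem (h j hj) _ : ∀ j ∈ s, (t j).indicator (1 : (Fin L → ℝ) → ℝ≥0∞)
          (ω j) = 1)]
      simp
    · rw [Set.indicator_of_notMem h]
      simp only [Set.mem_pi, not_forall] at h
      obtain ⟨j, hj, hj2⟩ := h
      rw [Finset.prod_eq_zero (i := j) (s := s) hj (Set.indicator_of_notMem hj2 _), mul_zero]
  rw [withDensity_apply _ hs, ← lintegral_indicator hs, lintegral_congr h1,
    lintegral_prod_coord μ _ hwm]
  have h2 : ∀ j, ∫⁻ x, w j x ∂(μ j) = if j ∈ s then μ' j (t j) else 1 := fun j => by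
    have h3 : ∫⁻ x, w j x ∂(μ j) = ∫⁻ x, (if j ∈ s then (t j).indicator 1 x else 1) ∂(μ' j) := by
      have h4 : Measurable fun x => (if j ∈ s then (t j).indicator 1 x else 1 : ℝ≥0∞) := by
        split_ifs
        · exact measurable_one.indicator (ht j)
        · exact measurable_const
      by_cases hj : j ∈ J
      · rw [hJ j hj, lintegral_withDensity_eq_lintegral_mul _ (hv j) h4]
        simp [hw, hj]
      · rw [hJc j hj]
        simp [hw, hj]
    rw [h3]
    split_ifs
    · exact lintegral_indicator_one (ht j)
    · simp
  rw [Finset.prod_congr rfl fun j _ => h2 j, Finset.prod_ite_mem, Finset.union_inter_cancel_right]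

end ProductLaws

/-! ### Tail-sum formulas for detection times -/

section DetectionTimes

variable {L : ℕ} {τ : Obs L → ℕ∞}

theorem IsDetectionTime.measurableSet_lt (h : IsDetectionTime τ) (k : ℕ) :
    MeasurableSet[obsFiltration L k] {ω | (k : ℕ∞) < τ ω} := by
  have h1 := (h.1 k).compl
  convert h1 using 1
  ext ω
  exact (not_le (a := τ ω) (b := (k : ℕ∞))).symm

/-- The subtraction is truncated, so both sides vanish for `n ≤ ν`, and both are infinite for `n =
⊤`. -/
theorem coe_sub_eq_tsum (n : ℕ∞) (ν : ℕ) :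
    (n : ℝ≥0∞) - ν = ∑' k : ℕ, if ((ν + k : ℕ) : ℕ∞) < n then (1 : ℝ≥0∞) else 0 := by
  induction n using ENat.recTopCoe with
  | top => simp
  | coe a =>
    have : ∀ k ∉ Finset.range (a - ν), (if ((ν + k : ℕ) : ℕ∞) < (a : ℕ∞) then (1 : ℝ≥0∞) else 0)
        = 0 := fun k hk => by
      rw [if_neg]
      rw [Nat.cast_lt]
      simp at hk; omega
    rw [tsum_eq_sum this, Finset.sum_congr rfl (g := fun _ => 1)]
    · simp
    · intro k hk
      rw [if_pos]
      rw [Nat.cast_lt]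
      simp at hk; omega

theorem lintegral_sub_eq_tsum (h : IsDetectionTime τ) (ν : ℕ) (P : Measure (Obs L)) :
    ∫⁻ ω, ((τ ω : ℝ≥0∞) - ν) ∂P = ∑' k : ℕ, P {ω | ((ν + k : ℕ) : ℕ∞) < τ ω} := by
  simp_rw [coe_sub_eq_tsum]
  have hm : ∀ k : ℕ, MeasurableSet {ω | ((ν + k : ℕ) : ℕ∞) < τ ω} := fun k =>
    (obsFiltration L).le _ _ (h.measurableSet_lt _)
  rw [lintegral_tsum]
  · congr 1 with k
    rw [← lintegral_indicator_one (hm k)]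
    exact lintegral_congr fun ω => by simp [Set.indicator_apply]
  · intro k
    exact (Measurable.ite (hm k) measurable_const measurable_const).aemeasurable

theorem lintegral_eq_tsum (h : IsDetectionTime τ) (P : Measure (Obs L)) :
    ∫⁻ ω, (τ ω : ℝ≥0∞) ∂P = ∑' k : ℕ, P {ω | (k : ℕ∞) < τ ω} := by
  simpa using lintegral_sub_eq_tsum h 0 P

end DetectionTimes

/-! ### One-step laws and their likelihood ratios -/

section Laws

variable {L m : ℕ} {f g : Fin L → ℝ → ℝ≥0}

theorem lintegral_prod_eval_volume {h : Fin L → ℝ → ℝ≥0} (hm : ∀ l, Measurable (h l))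
    (hfin : ∀ l, ∫⁻ x, (h l x : ℝ≥0∞) ≠ ∞) :
    ∫⁻ x : Fin L → ℝ, ∏ l, (h l (x l) : ℝ≥0∞) = ∏ l, ∫⁻ x, (h l x : ℝ≥0∞) := by
  have hi : ∀ l, Integrable (fun x => (h l x : ℝ)) := fun l => by
    refine ⟨(hm l).coe_nnreal_real.aestronglyMeasurable, ?_⟩
    rw [hasFiniteIntegral_iff_enorm]
    simpa [enorm_eq_nnnorm] using (hfin l).lt_top
  have h1 := integral_fintype_prod_volume_eq_prod (𝕜 := ℝ) (fun l x => (h l x : ℝ))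
  have h2 := Integrable.fintype_prod (𝕜 := ℝ) (μ := fun _ : Fin L => (volume : Measure ℝ)) hi
  have h3 : ∀ l, ∫⁻ x, (h l x : ℝ≥0∞) = ENNReal.ofReal (∫ x, (h l x : ℝ)) := fun l =>
    lintegral_coe_eq_integral _ (hi l)
  have h4 := lintegral_coe_eq_integral (fun x : Fin L → ℝ => ∏ l, h l (x l))
    (μ := volume) (by simpa [NNReal.coe_prod, volume_pi] using h2)
  simp only [ENNReal.ofNNReal_finsetProd, NNReal.coe_prod] at h4
  rw [h4, h1, ENNReal.ofReal_prod_of_nonneg fun l _ => integral_nonneg fun x => NNReal.coe_nonneg _]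
  exact Finset.prod_congr rfl fun l _ => (h3 l).symm

theorem pi_withDensity_eq {h : Fin L → ℝ → ℝ≥0} (hh : ∀ l, IsPdf (h l)) :
    Measure.pi (fun l => (volume : Measure ℝ).withDensity fun x => (h l x : ℝ≥0∞)) =
      volume.withDensity fun x : Fin L → ℝ => ∏ l, (h l (x l) : ℝ≥0∞) := by
  have : ∀ l, IsProbabilityMeasure ((volume : Measure ℝ).withDensity fun x => (h l x : ℝ≥0∞)) :=
    fun l => ⟨by simpa using (hh l).2⟩
  refine Measure.pi_eq fun s hs => ?_
  rw [withDensity_apply _ (MeasurableSet.univ_pi hs), ← lintegral_indicator (.univ_pi hs)]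
  have h1 := lintegral_prod_eval_volume (h := fun l => (s l).indicator (h l))
    (fun l => (hh l).1.indicator (hs l)) fun l => by
      refine ne_top_of_le_ne_top ENNReal.one_ne_top (le_trans (lintegral_mono fun x => ?_)
        (hh l).2.le)
      exact ENNReal.coe_le_coe.2 (Set.indicator_le_self' (fun _ _ => zero_le) x)
  refine Eq.trans ?_ (h1.trans (Finset.prod_congr rfl fun l _ => ?_))
  · refine lintegral_congr fun x => ?_
    by_cases hx : x ∈ Set.univ.pi s
    · rw [Set.indicator_of_mem hx]
      exact Finset.prod_congr rfl fun l _ => by rw [Set.indicator_of_mem (hx l trivial)]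
    · rw [Set.indicator_of_notMem hx]
      simp only [Set.mem_pi, not_forall] at hx
      obtain ⟨l, _, hl⟩ := hx
      rw [Finset.prod_eq_zero (Finset.mem_univ l)]
      rw [Set.indicator_of_notMem hl, ENNReal.coe_zero]
  · rw [withDensity_apply _ (hs l), ← lintegral_indicator (hs l)]
    refine lintegral_congr fun x => ?_
    by_cases hx : x ∈ s l <;> simp [hx]

theorem jointDensity_eq_prod (E : Finset (Fin L)) (x : Fin L → ℝ) :
    jointDensity f g E x = ∏ l, ((if l ∈ E then f l else g l) (x l) : ℝ≥0∞) := by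
  classical
  rw [jointDensity, ← Finset.prod_mul_prod_compl E fun l =>
    ((if l ∈ E then f l else g l) (x l) : ℝ≥0∞)]
  congr 1
  · exact Finset.prod_congr rfl fun l hl => by rw [if_pos hl]
  · exact Finset.prod_congr rfl fun l hl => by rw [if_neg (Finset.mem_compl.1 hl)]

theorem jointLaw_eq_pi (hf : ∀ l, IsPdf (f l)) (hg : ∀ l, IsPdf (g l)) (E : Finset (Fin L)) :
    jointLaw f g E = Measure.pi fun l => (volume : Measure ℝ).withDensity
      fun x => ((if l ∈ E then f l else g l) x : ℝ≥0∞) := by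
  rw [pi_withDensity_eq fun l => by split_ifs; exacts [hf l, hg l], jointLaw]
  congr 1
  ext x
  exact jointDensity_eq_prod E x

theorem preLaw_eq_pi (hg : ∀ l, IsPdf (g l)) :
    preLaw g = Measure.pi fun l => (volume : Measure ℝ).withDensity
      fun x => (g l x : ℝ≥0∞) :=
  (pi_withDensity_eq hg).symm

theorem IsPdf.isProbabilityMeasure {h : ℝ → ℝ≥0} (hh : IsPdf h) :
    IsProbabilityMeasure ((volume : Measure ℝ).withDensity fun x => (h x : ℝ≥0∞)) :=
  ⟨by simpa using hh.2⟩

theorem isProbabilityMeasure_jointLaw (hf : ∀ l, IsPdf (f l)) (hg : ∀ l, IsPdf (g l))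
    (E : Finset (Fin L)) : IsProbabilityMeasure (jointLaw f g E) := by
  rw [jointLaw_eq_pi hf hg]
  have : ∀ l, IsProbabilityMeasure ((volume : Measure ℝ).withDensity
      fun x => ((if l ∈ E then f l else g l) x : ℝ≥0∞)) := fun l =>
    IsPdf.isProbabilityMeasure (by split_ifs; exacts [hf l, hg l])
  infer_instance

theorem isProbabilityMeasure_preLaw (hg : ∀ l, IsPdf (g l)) :
    IsProbabilityMeasure (preLaw g) := by
  rw [preLaw_eq_pi hg]
  have := fun l => (hg l).isProbabilityMeasure
  infer_instance

theorem measurable_preDensity (hg : ∀ l, Measurable (g l)) : Measurable (preDensity g) :=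
  Finset.measurable_fun_prod _ fun l _ =>
    ((hg l).comp (measurable_pi_apply l)).coe_nnreal_ennreal

theorem measurable_jointDensity (hf : ∀ l, Measurable (f l)) (hg : ∀ l, Measurable (g l))
    (E : Finset (Fin L)) : Measurable (jointDensity f g E) :=
  (Finset.measurable_fun_prod _ fun l _ =>
    ((hf l).comp (measurable_pi_apply l)).coe_nnreal_ennreal).mul
  (Finset.measurable_fun_prod _ fun l _ =>
    ((hg l).comp (measurable_pi_apply l)).coe_nnreal_ennreal)

theorem measurable_mixDensity (hf : ∀ l, Measurable (f l)) (hg : ∀ l, Measurable (g l))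
    (α : PMF (Placement L m)) : Measurable (mixDensity f g α) :=
  Finset.measurable_fun_sum _ fun E _ => (measurable_jointDensity hf hg E.1).const_mul _

theorem preDensity_ne_top (x : Fin L → ℝ) : preDensity g x ≠ ∞ :=
  ENNReal.prod_ne_top fun _ _ => ENNReal.coe_ne_top

/-- The likelihood ratio of the placement `E` to the density before the change. -/
noncomputable def jointRatio (f g : Fin L → ℝ → ℝ≥0) (E : Finset (Fin L))
    (x : Fin L → ℝ) : ℝ≥0∞ :=
  jointDensity f g E x / preDensity g x

theorem measurable_jointRatio (hf : ∀ l, Measurable (f l)) (hg : ∀ l, Measurable (g l))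
    (E : Finset (Fin L)) : Measurable (jointRatio f g E) :=
  (measurable_jointDensity hf hg E).div (measurable_preDensity hg)

theorem measurable_mixRatio (hf : ∀ l, Measurable (f l)) (hg : ∀ l, Measurable (g l))
    (α : PMF (Placement L m)) : Measurable (mixRatio f g α) :=
  (measurable_mixDensity hf hg α).div (measurable_preDensity hg)

theorem mixRatio_eq_sum (α : PMF (Placement L m)) (x : Fin L → ℝ) :
    mixRatio f g α x = ∑ E : Placement L m, α E * jointRatio f g E.1 x := by
  simp only [mixRatio, mixDensity, jointRatio, div_eq_mul_inv, Finset.sum_mul, mul_assoc]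

theorem mixLaw_eq_sum (hf : ∀ l, Measurable (f l)) (hg : ∀ l, Measurable (g l))
    (α : PMF (Placement L m)) :
    mixLaw f g α = ∑ E : Placement L m, α E • jointLaw f g E.1 := by
  ext s hs
  rw [mixLaw, withDensity_apply _ hs]
  simp only [mixDensity, Measure.coe_finsetSum, Finset.sum_apply, Measure.smul_apply, jointLaw,
    withDensity_apply _ hs, smul_eq_mul]
  rw [lintegral_finsetSum _ fun E _ => (measurable_jointDensity hf hg E.1).const_mul _]
  exact Finset.sum_congr rfl fun E _ => lintegral_const_mul _ (measurable_jointDensity hf hg E.1)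

theorem isProbabilityMeasure_mixLaw (hf : ∀ l, IsPdf (f l)) (hg : ∀ l, IsPdf (g l))
    (α : PMF (Placement L m)) : IsProbabilityMeasure (mixLaw f g α) := by
  constructor
  rw [mixLaw_eq_sum (fun l => (hf l).1) fun l => (hg l).1]
  have := isProbabilityMeasure_jointLaw hf hg
  simp only [Measure.coe_finsetSum, Finset.sum_apply, Measure.smul_apply, measure_univ,
    smul_eq_mul, mul_one]
  rw [← tsum_fintype (L := .unconditional _)]
  exact α.tsum_coe

/-- Division recovers `p` as `q * (p / q)` except where `q = 0`; absolute continuity says precisely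
that `p` vanishes almost everywhere there. -/
theorem withDensity_div_of_ac {X : Type*} [MeasurableSpace X] {μ : Measure X} {p q : X → ℝ≥0∞}
    (hp : Measurable p) (hq : Measurable q) (hq' : ∀ x, q x ≠ ∞)
    (h : μ.withDensity p ≪ μ.withDensity q) :
    μ.withDensity p = (μ.withDensity q).withDensity fun x => p x / q x := by
  refine Eq.trans ?_ (withDensity_mul μ hq (hp.div hq))
  refine withDensity_congr_ae ?_
  have hN : MeasurableSet {x | q x = 0} := hq (measurableSet_singleton 0)
  have h1 : μ.withDensity p {x | q x = 0} = 0 := h <| by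
    rw [withDensity_apply _ hN, lintegral_eq_zero_iff hq]
    exact (ae_restrict_iff' hN).2 (ae_of_all _ fun x hx => hx)
  rw [withDensity_apply _ hN, lintegral_eq_zero_iff hp] at h1
  filter_upwards [(ae_restrict_iff' hN).1 h1] with x hx
  by_cases h0 : q x = 0
  · have : p x = 0 := hx h0
    simp [h0, this]
  · exact (ENNReal.mul_div_cancel h0 (hq' x)).symm

theorem mixDensity_pure (E : Placement L m) :
    mixDensity f g (PMF.pure E) = jointDensity f g E.1 := by
  classical
  ext x
  simp [mixDensity, PMF.pure_apply]

theorem mixRatio_pure (E : Placement L m) :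
    mixRatio f g (PMF.pure E) = jointRatio f g E.1 := by
  ext x
  rw [mixRatio, mixDensity_pure, jointRatio]

theorem mixLaw_pure (E : Placement L m) :
    mixLaw f g (PMF.pure E) = jointLaw f g E.1 := by
  rw [mixLaw, mixDensity_pure, jointLaw]

theorem mixLaw_ac {α : PMF (Placement L m)} (hI : klNumber f g α < ∞) :
    mixLaw f g α ≪ preLaw g :=
  (InformationTheory.klDiv_ne_top_iff.1 hI.ne).1

theorem mixLaw_eq_withDensity (hf : ∀ l, Measurable (f l)) (hg : ∀ l, Measurable (g l))
    {α : PMF (Placement L m)} (hI : klNumber f g α < ∞) :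
    mixLaw f g α = (preLaw g).withDensity (mixRatio f g α) :=
  withDensity_div_of_ac (measurable_mixDensity hf hg α) (measurable_preDensity hg)
    preDensity_ne_top (mixLaw_ac hI)

/-- A point mass is itself a mixture, and its finite Kullback–Leibler number supplies the absolute
continuity of `p_E`. -/
theorem jointLaw_eq_withDensity (hf : ∀ l, Measurable (f l)) (hg : ∀ l, Measurable (g l))
    {E : Placement L m} (hI : klNumber f g (PMF.pure E) < ∞) :
    jointLaw f g E.1 = (preLaw g).withDensity (jointRatio f g E.1) := by
  rw [← mixLaw_pure, mixLaw_eq_withDensity hf hg hI, mixRatio_pure]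

end Laws

/-! ### False alarms and the Shiryaev–Roberts martingale -/

section FalseAlarm

variable {L : ℕ}

theorem measurable_prod_past {r : (Fin L → ℝ) → ℝ≥0∞} (hr : Measurable r) (i k : ℕ) :
    Measurable[obsFiltration L k] fun ω : Obs L => ∏ j ∈ Finset.Ico i k, r (ω j) :=
  Finset.measurable_fun_prod _ fun _ hj =>
    hr.comp (measurable_coord_past (Finset.mem_Ico.1 hj).2)

theorem coe_lt_iff_succ_lt_or_eq {k : ℕ} {n : ℕ∞} :
    (k : ℕ∞) < n ↔ ((k + 1 : ℕ) : ℕ∞) < n ∨ n = ((k + 1 : ℕ) : ℕ∞) := by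
  rw [or_comm, eq_comm, ← le_iff_eq_or_lt]
  push_cast
  exact (Order.add_one_le_iff_of_not_isMax (by simp)).symm

theorem IsDetectionTime.measurableSet_eq_succ {τ : Obs L → ℕ∞} (hτ : IsDetectionTime τ) (k : ℕ) :
    MeasurableSet[obsFiltration L (k + 1)] {ω | τ ω = ((k + 1 : ℕ) : ℕ∞)} := by
  have : {ω | τ ω = ((k + 1 : ℕ) : ℕ∞)} =
      {ω | (k : ℕ∞) < τ ω} \ {ω | ((k + 1 : ℕ) : ℕ∞) < τ ω} := by
    ext ω
    simp only [Set.mem_sdiff, Set.mem_ofPred_eq, coe_lt_iff_succ_lt_or_eq (k := k)]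
    exact ⟨fun h => ⟨Or.inr h, h.le.not_gt⟩, fun h => h.1.resolve_left h.2⟩
  rw [this]
  exact ((obsFiltration L).mono k.le_succ _ (hτ.measurableSet_lt k)).diff
    (hτ.measurableSet_lt (k + 1))

theorem setOf_lt_eq_union (τ : Obs L → ℕ∞) (k : ℕ) :
    {ω | (k : ℕ∞) < τ ω} =
      {ω | ((k + 1 : ℕ) : ℕ∞) < τ ω} ∪ {ω | τ ω = ((k + 1 : ℕ) : ℕ∞)} :=
  Set.ext fun _ => coe_lt_iff_succ_lt_or_eq

theorem disjoint_lt_eq (τ : Obs L → ℕ∞) (k : ℕ) :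
    Disjoint {ω | (k : ℕ∞) < τ ω} {ω | τ ω = (k : ℕ∞)} :=
  Set.disjoint_left.2 fun _ h1 h2 => absurd h2 (ne_of_gt h1)

/-- The Shiryaev–Roberts statistic with likelihood ratio `r`. -/
noncomputable def shiryaevRoberts (r : (Fin L → ℝ) → ℝ≥0∞) (k : ℕ) (ω : Obs L) : ℝ≥0∞ :=
  ∑ i ∈ Finset.range k, ∏ j ∈ Finset.Ico i k, r (ω j)

theorem shiryaevRoberts_succ (r : (Fin L → ℝ) → ℝ≥0∞) (k : ℕ) (ω : Obs L) :
    shiryaevRoberts r (k + 1) ω = (shiryaevRoberts r k ω + 1) * r (ω k) := by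
  rw [shiryaevRoberts, Finset.sum_range_succ, shiryaevRoberts, add_mul, Finset.sum_mul]
  congr 1
  · exact Finset.sum_congr rfl fun i hi =>
      Finset.prod_Ico_succ_top (Finset.mem_range.1 hi).le _
  · simp

theorem measurable_shiryaevRoberts {r : (Fin L → ℝ) → ℝ≥0∞} (hr : Measurable r) (k : ℕ) :
    Measurable[obsFiltration L k] (shiryaevRoberts r k) :=
  Finset.measurable_fun_sum _ fun i _ => measurable_prod_past hr i k

/-- The recursion `shiryaevRoberts_succ` and `∫ r = 1` make the statistic minus `k` a martingale.
Optional stopping is carried out by hand: on `τ > k` the mean grows by `P(τ > k)`, and the mass that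
stops at `k + 1` carries at least `c`. Telescoping gives `c * P(τ ≤ n) ≤ ∑ k < n, P(τ > k)`. -/
theorem le_lintegral_of_le_shiryaevRoberts {G : Measure (Fin L → ℝ)} [IsProbabilityMeasure G]
    {r : (Fin L → ℝ) → ℝ≥0∞} (hr : Measurable r) (hr1 : ∫⁻ x, r x ∂G = 1)
    {τ : Obs L → ℕ∞} (hτ : IsDetectionTime τ) {c : ℝ≥0∞}
    (h : ∀ k ω, τ ω = ((k + 1 : ℕ) : ℕ∞) → c ≤ shiryaevRoberts r (k + 1) ω) :
    c ≤ ∫⁻ ω, (τ ω : ℝ≥0∞) ∂(Measure.infinitePi fun _ => G) := by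
  set P := Measure.infinitePi fun _ : ℕ => G with hP
  have hm : ∀ k : ℕ, MeasurableSet {ω | (k : ℕ∞) < τ ω} := fun k =>
    (obsFiltration L).le _ _ (hτ.measurableSet_lt k)
  have hme : ∀ k : ℕ, MeasurableSet {ω | τ ω = ((k + 1 : ℕ) : ℕ∞)} := fun k =>
    (obsFiltration L).le _ _ (hτ.measurableSet_eq_succ k)
  have hRm : ∀ k, Measurable (shiryaevRoberts r k) := fun k =>
    (measurable_shiryaevRoberts hr k).mono ((obsFiltration L).le k) le_rfl
  have step : ∀ k : ℕ, ∫⁻ ω in {ω | (k : ℕ∞) < τ ω}, shiryaevRoberts r (k + 1) ω ∂P =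
      ∫⁻ ω in {ω | (k : ℕ∞) < τ ω}, shiryaevRoberts r k ω ∂P + P {ω | (k : ℕ∞) < τ ω} := by
    intro k
    have h1 := lintegral_past_mul_coord (fun _ => G) k
      (u := {ω | (k : ℕ∞) < τ ω}.indicator fun ω => shiryaevRoberts r k ω + 1) (v := r)
      (Measurable.indicator ((measurable_shiryaevRoberts hr k).add_const 1)
        (hτ.measurableSet_lt k)) hr
    rw [hr1, mul_one, lintegral_indicator (hm k), lintegral_add_right _ measurable_const,
      setLIntegral_const, one_mul] at h1
    rw [← h1, ← lintegral_indicator (hm k)]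
    refine lintegral_congr fun ω => ?_
    by_cases hω : ω ∈ {ω | (k : ℕ∞) < τ ω}
    · rw [Set.indicator_of_mem hω, Set.indicator_of_mem hω, shiryaevRoberts_succ]
    · rw [Set.indicator_of_notMem hω, Set.indicator_of_notMem hω, zero_mul]
  have split : ∀ k : ℕ, ∫⁻ ω in {ω | ((k + 1 : ℕ) : ℕ∞) < τ ω}, shiryaevRoberts r (k + 1) ω ∂P +
      c * P {ω | τ ω = ((k + 1 : ℕ) : ℕ∞)} ≤
      ∫⁻ ω in {ω | (k : ℕ∞) < τ ω}, shiryaevRoberts r (k + 1) ω ∂P := by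
    intro k
    rw [setOf_lt_eq_union τ k, lintegral_union (hme k) (disjoint_lt_eq τ _)]
    gcongr
    rw [← setLIntegral_const]
    exact setLIntegral_mono' (hme k) fun ω hω => h k ω hω
  have tele : ∀ n : ℕ, c * P {ω | ¬ (n : ℕ∞) < τ ω} ≤
      ∑ k ∈ Finset.range n, P {ω | (k : ℕ∞) < τ ω} := by
    have aux : ∀ n : ℕ, ∫⁻ ω in {ω | (n : ℕ∞) < τ ω}, shiryaevRoberts r n ω ∂P +
        c * P {ω | ¬ (n : ℕ∞) < τ ω} ≤ ∑ k ∈ Finset.range n, P {ω | (k : ℕ∞) < τ ω} := by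
      intro n
      induction n with
      | zero =>
        have : {ω | ¬ ((0 : ℕ) : ℕ∞) < τ ω} = ∅ := by
          ext ω
          simpa using (lt_of_lt_of_le zero_lt_one (hτ.2 ω)).ne'
        rw [this]
        simp [shiryaevRoberts]
      | succ n ih =>
        have h1 : {ω | ¬ ((n + 1 : ℕ) : ℕ∞) < τ ω} ⊆
            {ω | τ ω = ((n + 1 : ℕ) : ℕ∞)} ∪ {ω | ¬ (n : ℕ∞) < τ ω} := by
          intro ω hω
          simp only [Set.mem_union, Set.mem_ofPred_eq, not_lt] at hω ⊢
          rcases hω.eq_or_lt with h | h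
          · exact Or.inl h
          · exact Or.inr (ENat.lt_natCast_add_one_iff.1 (by exact_mod_cast h))
        rw [Finset.sum_range_succ]
        calc _ ≤ ∫⁻ ω in {ω | ((n + 1 : ℕ) : ℕ∞) < τ ω}, shiryaevRoberts r (n + 1) ω ∂P +
              c * (P {ω | τ ω = ((n + 1 : ℕ) : ℕ∞)} + P {ω | ¬ (n : ℕ∞) < τ ω}) := by
              gcongr
              exact (measure_mono h1).trans (measure_union_le _ _)
          _ ≤ ∫⁻ ω in {ω | (n : ℕ∞) < τ ω}, shiryaevRoberts r (n + 1) ω ∂P +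
              c * P {ω | ¬ (n : ℕ∞) < τ ω} := by
              rw [mul_add, ← add_assoc]
              gcongr
              exact split n
          _ ≤ _ := by
              rw [step, add_right_comm]
              gcongr
    exact fun n => le_trans le_add_self (aux n)
  rw [lintegral_eq_tsum hτ]
  -- An infinite mean leaves nothing to prove; a finite one forces `P(τ ≤ n) → 1`, so the factor in
  -- front of `c` disappears in the limit.
  by_cases htop : ∑' k : ℕ, P {ω | (k : ℕ∞) < τ ω} = ∞
  · rw [htop]; exact le_top
  have hto : Tendsto (fun n : ℕ => P {ω | ¬ (n : ℕ∞) < τ ω}) atTop (𝓝 1) := by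
    have h1 := ENNReal.tendsto_atTop_zero_of_tsum_ne_top htop
    have h2 : ∀ n : ℕ, P {ω | ¬ (n : ℕ∞) < τ ω} = 1 - P {ω | (n : ℕ∞) < τ ω} := fun n =>
      prob_compl_eq_one_sub (hm n)
    simp_rw [h2]
    simpa using ENNReal.Tendsto.sub tendsto_const_nhds h1 (Or.inl ENNReal.one_ne_top)
  have h3 := ENNReal.Tendsto.const_mul (a := c) hto (Or.inl one_ne_zero)
  rw [mul_one] at h3
  exact le_of_tendsto h3 (Eventually.of_forall fun n => (tele n).trans (ENNReal.sum_le_tsum _))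

end FalseAlarm

/-! ### The M-CUSUM time and its mean time to false alarm -/

section MCusum

variable {L m : ℕ} {f g : Fin L → ℝ → ℝ≥0} {α : PMF (Placement L m)} {b : ℝ}

theorem lt_mCusumTime_iff (k : ℕ) (ω : Obs L) :
    (k : ℕ∞) < mCusumTime f g α b ω ↔
      ∀ n, 1 ≤ n → n ≤ k → mCusumStat f g α n ω < ENNReal.ofReal (Real.exp b) := by
  constructor
  · intro h n hn hnk
    by_contra hc
    exact absurd (lt_of_lt_of_le h (iInf₂_le n ⟨hn, not_lt.1 hc⟩))
      (not_lt.2 (by exact_mod_cast hnk))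
  · intro h
    refine lt_of_lt_of_le (b := ((k + 1 : ℕ) : ℕ∞)) (by exact_mod_cast Nat.lt_succ_self k)
      (le_iInf₂ fun n hn => ?_)
    by_contra hc
    have : n < k + 1 := by exact_mod_cast not_le.1 hc
    exact absurd (h n hn.1 (by omega)) (not_lt.2 hn.2)

theorem mCusumStat_eq_of_mCusumTime_eq {k : ℕ} {ω : Obs L}
    (h : mCusumTime f g α b ω = ((k + 1 : ℕ) : ℕ∞)) :
    ENNReal.ofReal (Real.exp b) ≤ mCusumStat f g α (k + 1) ω := by
  by_contra hc
  have h1 : (k : ℕ∞) < mCusumTime f g α b ω := by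
    rw [h]; exact_mod_cast Nat.lt_succ_self k
  rw [lt_mCusumTime_iff] at h1
  have h2 : ((k + 1 : ℕ) : ℕ∞) < mCusumTime f g α b ω := by
    rw [lt_mCusumTime_iff]
    intro n hn hnk
    rcases hnk.eq_or_lt with rfl | h3
    · exact not_le.1 hc
    · exact h1 n hn (by omega)
  exact absurd h (ne_of_gt h2)

theorem measurable_mCusumStat (hf : ∀ l, Measurable (f l)) (hg : ∀ l, Measurable (g l)) (k : ℕ) :
    Measurable[obsFiltration L k] (mCusumStat f g α k) := by
  have : mCusumStat f g α k =
      (Finset.range k).sup fun i => fun ω : Obs L => ∏ j ∈ Finset.Ico i k, mixRatio f g α (ω j) := by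
    ext ω
    rw [mCusumStat, Finset.sup_apply]
  rw [this]
  exact Finset.sup_induction (p := fun h => Measurable[obsFiltration L k] h)
    (@measurable_const _ _ _ (obsFiltration L k) (⊥ : ℝ≥0∞)) (fun _ ha _ hb => ha.sup hb)
    fun i _ => measurable_prod_past (measurable_mixRatio hf hg α) i k

theorem isDetectionTime_mCusumTime (hf : ∀ l, Measurable (f l)) (hg : ∀ l, Measurable (g l)) :
    IsDetectionTime (mCusumTime f g α b) := by
  refine ⟨fun k => ?_, fun ω => le_iInf₂ fun n hn => by exact_mod_cast hn.1⟩
  have h : {ω | mCusumTime f g α b ω ≤ ((k : ℕ) : ℕ∞)} =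
      ⋃ n ∈ Finset.Icc 1 k, {ω | ENNReal.ofReal (Real.exp b) ≤ mCusumStat f g α n ω} := by
    ext ω
    have := (lt_mCusumTime_iff (f := f) (g := g) (α := α) (b := b) k ω).not
    simp only [not_lt] at this
    simp only [Set.mem_ofPred_eq, this, Set.mem_iUnion, Finset.mem_Icc]
    push Not
    simp [and_assoc]
  change MeasurableSet[obsFiltration L k] {ω | mCusumTime f g α b ω ≤ ((k : ℕ) : ℕ∞)}
  rw [h]
  refine Finset.measurableSet_biUnion _ fun n hn => ?_
  exact (obsFiltration L).mono (Finset.mem_Icc.1 hn).2 _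
    (measurable_mCusumStat hf hg n measurableSet_Ici)

theorem mCusumStat_le_shiryaevRoberts (k : ℕ) (ω : Obs L) :
    mCusumStat f g α k ω ≤ shiryaevRoberts (mixRatio f g α) k ω :=
  Finset.sup_le fun _ hi => Finset.single_le_sum
    (f := fun i => ∏ j ∈ Finset.Ico i k, mixRatio f g α (ω j)) (fun _ _ => zero_le) hi

theorem ofReal_exp_le_mtfa_mCusumTime (hf : ∀ l, IsPdf (f l)) (hg : ∀ l, IsPdf (g l))
    (hI : klNumber f g α < ∞) :
    ENNReal.ofReal (Real.exp b) ≤ mtfa g (mCusumTime f g α b) := by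
  have hf' := fun l => (hf l).1
  have hg' := fun l => (hg l).1
  have := isProbabilityMeasure_preLaw hg
  have h1 := (isProbabilityMeasure_mixLaw hf hg α).measure_univ
  rw [mixLaw_eq_withDensity hf' hg' hI, withDensity_apply _ MeasurableSet.univ,
    setLIntegral_univ] at h1
  exact le_lintegral_of_le_shiryaevRoberts (measurable_mixRatio hf' hg' α) h1
    (isDetectionTime_mCusumTime hf' hg') fun k ω h =>
      (mCusumStat_eq_of_mCusumTime_eq h).trans (mCusumStat_le_shiryaevRoberts _ _)

end MCusum

/-! ### Mean crossing time of a walk with positive drift -/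

section RandomWalk

variable {L : ℕ}

/-- The event that the random walk with increments `y (ω j)`, started at time `ν`, stays below `b`
for its first `k` steps. -/
def walkBelow (y : (Fin L → ℝ) → ℝ) (b : ℝ) (ν k : ℕ) : Set (Obs L) :=
  {ω | ∀ n ≤ k, ∑ j ∈ Finset.range n, y (ω (ν + j)) < b}

theorem measurableSet_walkBelow_of {y : (Fin L → ℝ) → ℝ} (b : ℝ) {ν k : ℕ}
    {F : MeasurableSpace (Obs L)}
    (h : ∀ j < k, Measurable[F] fun ω : Obs L => y (ω (ν + j))) :
    MeasurableSet[F] (walkBelow y b ν k) := by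
  have : walkBelow y b ν k =
      ⋂ n ∈ Finset.range (k + 1), {ω | ∑ j ∈ Finset.range n, y (ω (ν + j)) < b} := by
    ext ω; simp [walkBelow]
  rw [this]
  refine Finset.measurableSet_biInter _ fun n hn => ?_
  have h2 : Measurable[F] fun ω : Obs L => ∑ j ∈ Finset.range n, y (ω (ν + j)) :=
    Finset.measurable_fun_sum _ fun j hj => h j (by
      have := Finset.mem_range.1 hn; have := Finset.mem_range.1 hj; omega)
  exact h2 measurableSet_Iio

theorem measurableSet_walkBelow_past {y : (Fin L → ℝ) → ℝ} (hy : Measurable y) (b : ℝ) (ν k : ℕ) :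
    MeasurableSet[obsFiltration L (ν + k)] (walkBelow y b ν k) :=
  measurableSet_walkBelow_of b fun j hj => hy.comp (measurable_coord_past (by omega))

theorem measurableSet_walkBelow_future {y : (Fin L → ℝ) → ℝ} (hy : Measurable y) (b : ℝ)
    (ν k : ℕ) : MeasurableSet[futureSigma L ν] (walkBelow y b ν k) :=
  measurableSet_walkBelow_of b fun j _ => hy.comp (measurable_coord_future (by omega))

/-- The corrected increment is bounded above by `c`, which controls the overshoot, while its mean
drops by only `1 / (4 * c)` times the second moment. -/
theorem sub_sq_div_le {c : ℝ} (hc : 0 < c) (t : ℝ) : t - t ^ 2 / (4 * c) ≤ c := by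
  have : c - (t - t ^ 2 / (4 * c)) = (t - 2 * c) ^ 2 / (4 * c) := by field_simp; ring
  have h2 : 0 ≤ (t - 2 * c) ^ 2 / (4 * c) := by positivity
  linarith

/-- Corrected increments are summed up to and including the crossing step. Before it the sum is at
most the walk itself, hence below `b`, and the crossing step adds at most `c`. The induction carries
the comparison with the walk along. -/
theorem sum_indicator_walkBelow_le {y : (Fin L → ℝ) → ℝ} {b c : ℝ} (hb : 0 ≤ b) (hc : 0 < c)
    (ν n : ℕ) (ω : Obs L) :
    ∑ k ∈ Finset.range n, (walkBelow y b ν k).indicator 1 ω *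
      (y (ω (ν + k)) - y (ω (ν + k)) ^ 2 / (4 * c)) ≤ b + c := by
  suffices h : (ω ∈ walkBelow y b ν n → ∑ k ∈ Finset.range n, (walkBelow y b ν k).indicator 1 ω *
      (y (ω (ν + k)) - y (ω (ν + k)) ^ 2 / (4 * c)) ≤ ∑ j ∈ Finset.range n, y (ω (ν + j))) ∧
      ∑ k ∈ Finset.range n, (walkBelow y b ν k).indicator 1 ω *
      (y (ω (ν + k)) - y (ω (ν + k)) ^ 2 / (4 * c)) ≤ b + c from h.2
  induction n with
  | zero => simp; linarith
  | succ n ih =>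
    rw [Finset.sum_range_succ, Finset.sum_range_succ]
    by_cases hω : ω ∈ walkBelow y b ν n
    · rw [Set.indicator_of_mem hω, Pi.one_apply, one_mul]
      have h1 := ih.1 hω
      have h2 := sub_sq_div_le hc (y (ω (ν + n)))
      have h3 := hω n le_rfl
      have h4 : 0 ≤ y (ω (ν + n)) ^ 2 / (4 * c) := by positivity
      exact ⟨fun _ => by linarith, by linarith⟩
    · rw [Set.indicator_of_notMem hω, zero_mul, add_zero]
      exact ⟨fun h => absurd (fun k hk => h k (hk.trans n.le_succ)) hω, ih.2⟩

variable (μ : ℕ → Measure (Fin L → ℝ)) [∀ j, IsProbabilityMeasure (μ j)]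

/-- Wald's argument for increments whose law may change with time: whether the walk is still below
after `k` steps is decided before the next increment, so expectations factor and each term has mean
at least `I - M / (4 * c)` times the probability of being below. -/
theorem sum_measureReal_walkBelow_le {y : (Fin L → ℝ) → ℝ} (hy : Measurable y) {b c I M : ℝ}
    (hb : 0 ≤ b) (hc : 0 < c) {ν : ℕ} (hy1 : ∀ j ≥ ν, Integrable y (μ j))
    (hy2 : ∀ j ≥ ν, Integrable (fun x => y x ^ 2) (μ j)) (hI : ∀ j ≥ ν, I ≤ ∫ x, y x ∂(μ j))
    (hM : ∀ j ≥ ν, ∫ x, y x ^ 2 ∂(μ j) ≤ M) (n : ℕ) :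
    (I - M / (4 * c)) * ∑ k ∈ Finset.range n, (Measure.infinitePi μ).real (walkBelow y b ν k) ≤
      b + c := by
  set P := Measure.infinitePi μ with hP
  have hw : Measurable fun x => y x - y x ^ 2 / (4 * c) := hy.sub ((hy.pow_const 2).div_const _)
  have hwi : ∀ j ≥ ν, Integrable (fun x => y x - y x ^ 2 / (4 * c)) (μ j) := fun j hj =>
    (hy1 j hj).sub ((hy2 j hj).div_const _)
  have hm : ∀ k, Measurable[obsFiltration L (ν + k)]
      ((walkBelow y b ν k).indicator (1 : Obs L → ℝ)) := fun k =>
    Measurable.indicator (@measurable_const _ _ _ (obsFiltration L (ν + k)) (1 : ℝ))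
      (measurableSet_walkBelow_past hy b ν k)
  have hme : ∀ k, MeasurableSet (walkBelow y b ν k) := fun k =>
    (obsFiltration L).le _ _ (measurableSet_walkBelow_past hy b ν k)
  have hint : ∀ k, Integrable (fun ω : Obs L => (walkBelow y b ν k).indicator (1 : Obs L → ℝ) ω *
      (y (ω (ν + k)) - y (ω (ν + k)) ^ 2 / (4 * c))) P := fun k =>
    integrable_past_mul_coord μ (ν + k) (hm k) hw
      ((integrable_const (1 : ℝ)).indicator (hme k)) (hwi _ (by omega))
  have h1 : ∫ ω, ∑ k ∈ Finset.range n, (walkBelow y b ν k).indicator (1 : Obs L → ℝ) ω *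
      (y (ω (ν + k)) - y (ω (ν + k)) ^ 2 / (4 * c)) ∂P ≤ b + c := by
    calc _ ≤ ∫ _, (b + c) ∂P := integral_mono (integrable_finsetSum _ fun k _ => hint k)
          (integrable_const _) (sum_indicator_walkBelow_le hb hc ν n)
      _ = b + c := by simp
  refine le_trans ?_ h1
  rw [integral_finsetSum _ fun k _ => hint k, Finset.mul_sum]
  refine Finset.sum_le_sum fun k _ => ?_
  rw [integral_past_mul_coord μ (ν + k) (hm k) hw, integral_indicator_one (hme k), mul_comm]
  refine mul_le_mul_of_nonneg_left ?_ measureReal_nonneg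
  have hk : ν + k ≥ ν := by omega
  rw [integral_sub (hy1 _ hk) ((hy2 _ hk).div_const _), integral_div]
  have := div_le_div_of_nonneg_right (hM _ hk) (by positivity : 0 ≤ 4 * c)
  linarith [hI _ hk]

theorem tsum_measure_walkBelow_le {y : (Fin L → ℝ) → ℝ} (hy : Measurable y) {b c I M : ℝ}
    (hb : 0 ≤ b) (hc : 0 < c) {ν : ℕ} (hy1 : ∀ j ≥ ν, Integrable y (μ j))
    (hy2 : ∀ j ≥ ν, Integrable (fun x => y x ^ 2) (μ j)) (hI : ∀ j ≥ ν, I ≤ ∫ x, y x ∂(μ j))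
    (hM : ∀ j ≥ ν, ∫ x, y x ^ 2 ∂(μ j) ≤ M) (hpos : 0 < I - M / (4 * c)) :
    ∑' k, Measure.infinitePi μ (walkBelow y b ν k) ≤
      ENNReal.ofReal ((b + c) / (I - M / (4 * c))) := by
  refine ENNReal.tsum_le_of_sum_range_le fun n => ?_
  have h := sum_measureReal_walkBelow_le μ hy hb hc hy1 hy2 hI hM n
  have h2 : ENNReal.ofReal (∑ k ∈ Finset.range n,
      (Measure.infinitePi μ).real (walkBelow y b ν k)) =
      ∑ k ∈ Finset.range n, Measure.infinitePi μ (walkBelow y b ν k) := by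
    rw [ENNReal.ofReal_sum_of_nonneg fun _ _ => measureReal_nonneg]
    exact Finset.sum_congr rfl fun k _ => ofReal_measureReal
  rw [← h2]
  exact ENNReal.ofReal_le_ofReal ((le_div_iff₀' hpos).2 h)

end RandomWalk

/-! ### Worst-case delays, and the upper bound for M-CUSUM -/

section Delay

variable {L m : ℕ} {f g : Fin L → ℝ → ℝ≥0} {τ : Obs L → ℕ∞} {ν : ℕ}
  {S : AnomalyPath L m}

theorem isProbabilityMeasure_pathLaw_coord (hf : ∀ l, IsPdf (f l)) (hg : ∀ l, IsPdf (g l))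
    (ν : ℕ) (S : AnomalyPath L m) (j : ℕ) :
    IsProbabilityMeasure (if j < ν then preLaw g else jointLaw f g (S j).1) := by
  split_ifs
  exacts [isProbabilityMeasure_preLaw hg, isProbabilityMeasure_jointLaw hf hg _]

theorem isProbabilityMeasure_pathLaw (hf : ∀ l, IsPdf (f l)) (hg : ∀ l, IsPdf (g l))
    (ν : ℕ) (S : AnomalyPath L m) : IsProbabilityMeasure (pathLaw f g ν S) := by
  have := isProbabilityMeasure_pathLaw_coord hf hg ν S
  exact inferInstanceAs (IsProbabilityMeasure (Measure.infinitePi _))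

/-- The conditional expectation is measurable for the past at `ν`, so an almost sure bound can be
tested by integrating over past events `A`. The condition `1 ≤ C` covers the conventional value. -/
theorem worstDelay_le (hf : ∀ l, IsPdf (f l)) (hg : ∀ l, IsPdf (g l)) (hτ : IsDetectionTime τ)
    {C : ℝ≥0∞} (hC : 1 ≤ C)
    (h : ∀ A, MeasurableSet[obsFiltration L ν] A →
      ∑' k : ℕ, pathLaw f g ν S (A ∩ {ω | ((ν + k : ℕ) : ℕ∞) < τ ω}) ≤
        C * pathLaw f g ν S (A ∩ {ω | (ν : ℕ∞) < τ ω})) :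
    worstDelay f g τ ν S ≤ C := by
  have := isProbabilityMeasure_pathLaw hf hg ν S
  rw [worstDelay]
  split_ifs with h0
  · exact hC
  set P := pathLaw f g ν S with hP
  set D := {ω | (ν : ℕ∞) < τ ω} with hD
  have hDm : MeasurableSet D := (obsFiltration L).le _ _ (hτ.measurableSet_lt ν)
  have : IsProbabilityMeasure (P[|D]) := cond_isProbabilityMeasure h0
  refine essSup_le_of_ae_le _ (ae_le_of_ae_le_trim (hm := (obsFiltration L).le ν) ?_)
  refine ae_le_of_forall_setLIntegral_le_of_sigmaFinite (measurable_condLExp _ _ _) fun A hA _ => ?_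
  have hAm : MeasurableSet A := (obsFiltration L).le _ _ hA
  rw [setLIntegral_condLExp_trim _ _ _ hA, setLIntegral_const, trim_measurableSet_eq _ hA,
    lintegral_sub_eq_tsum hτ]
  have h1 : ∀ k : ℕ, (P[|D]).restrict A {ω | ((ν + k : ℕ) : ℕ∞) < τ ω} =
      (P D)⁻¹ * P (A ∩ {ω | ((ν + k : ℕ) : ℕ∞) < τ ω}) := fun k => by
    rw [Measure.restrict_apply' hAm, cond_apply hDm]
    congr 2
    ext ω
    simp only [Set.mem_inter_iff, Set.mem_ofPred_eq, hD]
    refine ⟨fun h => ⟨h.2.2, h.2.1⟩, fun h => ⟨lt_of_le_of_lt ?_ h.2, h.2, h.1⟩⟩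
    exact_mod_cast Nat.le_add_right ν k
  simp_rw [h1]
  rw [ENNReal.tsum_mul_left, cond_apply hDm, mul_left_comm, Set.inter_comm D A]
  gcongr
  exact h A hA

/-- A mean is at most an essential supremum. If `τ > ν` is null, both sides vanish and the
conventional value is harmless. -/
theorem tsum_le_worstDelay_mul (hf : ∀ l, IsPdf (f l)) (hg : ∀ l, IsPdf (g l))
    (hτ : IsDetectionTime τ) :
    ∑' k : ℕ, pathLaw f g ν S {ω | ((ν + k : ℕ) : ℕ∞) < τ ω} ≤
      worstDelay f g τ ν S * pathLaw f g ν S {ω | (ν : ℕ∞) < τ ω} := by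
  have := isProbabilityMeasure_pathLaw hf hg ν S
  have hsub : ∀ k : ℕ, {ω | ((ν + k : ℕ) : ℕ∞) < τ ω} ⊆ {ω | (ν : ℕ∞) < τ ω} := fun k ω hω =>
    lt_of_le_of_lt (b := ((ν + k : ℕ) : ℕ∞)) (by exact_mod_cast Nat.le_add_right ν k) hω
  rw [worstDelay]
  split_ifs with h0
  · rw [h0, mul_zero, nonpos_iff_eq_zero, ENNReal.tsum_eq_zero]
    exact fun k => measure_mono_null (hsub k) h0
  set P := pathLaw f g ν S with hP
  set D := {ω | (ν : ℕ∞) < τ ω} with hD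
  have hDm : MeasurableSet D := (obsFiltration L).le _ _ (hτ.measurableSet_lt ν)
  have : IsProbabilityMeasure (P[|D]) := cond_isProbabilityMeasure h0
  set X : Obs L → ℝ≥0∞ := fun ω => (τ ω : ℝ≥0∞) - ν with hX
  have h1 : ∫⁻ ω, X ω ∂(P[|D]) ≤ essSup (condLExp (obsFiltration L ν) (P[|D]) X) (P[|D]) := by
    rw [← lintegral_condLExp ((obsFiltration L).le ν)]
    exact (lintegral_mono_ae (ENNReal.ae_le_essSup _)).trans (by simp)
  have h2 : ∀ k : ℕ, (P[|D]) {ω | ((ν + k : ℕ) : ℕ∞) < τ ω} =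
      (P D)⁻¹ * P {ω | ((ν + k : ℕ) : ℕ∞) < τ ω} := fun k => by
    rw [cond_apply hDm, Set.inter_eq_right.2 (hsub k)]
  rw [hX, lintegral_sub_eq_tsum hτ] at h1
  simp_rw [h2] at h1
  rw [ENNReal.tsum_mul_left] at h1
  calc _ = P D * ((P D)⁻¹ * ∑' k : ℕ, P {ω | ((ν + k : ℕ) : ℕ∞) < τ ω}) := by
        rw [← mul_assoc, ENNReal.mul_inv_cancel h0 (measure_ne_top _ _), one_mul]
    _ ≤ _ := by rw [mul_comm (essSup _ _)]; gcongr

/-- No alarm by time `ν + k` forces the log-likelihood walk started at `ν` to stay below `b`. That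
event involves only observations after `ν`, so it is independent of the past, and the crossing bound
holds whatever `A` is. -/
theorem wadd_mCusumTime_le (hf : ∀ l, IsPdf (f l)) (hg : ∀ l, IsPdf (g l))
    {α : PMF (Placement L m)} {b c I M : ℝ} (hb : 0 < b) (hc : 0 < c)
    (hr : ∀ E : Placement L m, ∀ᵐ x ∂(jointLaw f g E.1), mixRatio f g α x ≠ 0 ∧
      mixRatio f g α x ≠ ∞)
    (hy1 : ∀ E : Placement L m,
      Integrable (fun x => Real.log (mixRatio f g α x).toReal) (jointLaw f g E.1))
    (hy2 : ∀ E : Placement L m,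
      Integrable (fun x => Real.log (mixRatio f g α x).toReal ^ 2) (jointLaw f g E.1))
    (hI : ∀ E : Placement L m, I ≤ ∫ x, Real.log (mixRatio f g α x).toReal ∂(jointLaw f g E.1))
    (hM : ∀ E : Placement L m,
      ∫ x, Real.log (mixRatio f g α x).toReal ^ 2 ∂(jointLaw f g E.1) ≤ M)
    (hpos : 0 < I - M / (4 * c)) :
    wadd m f g (mCusumTime f g α b) ≤
      max 1 (ENNReal.ofReal ((b + c) / (I - M / (4 * c)))) := by
  have hf' := fun l => (hf l).1
  have hg' := fun l => (hg l).1
  set y : (Fin L → ℝ) → ℝ := fun x => Real.log (mixRatio f g α x).toReal with hy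
  have hym : Measurable y := (measurable_mixRatio hf' hg' α).ennreal_toReal.log
  refine iSup₂_le fun S ν => worstDelay_le hf hg (isDetectionTime_mCusumTime hf' hg')
    (le_max_left _ _) fun A hA => ?_
  have hprob := isProbabilityMeasure_pathLaw_coord hf hg ν S
  set μ : ℕ → Measure (Fin L → ℝ) := fun j => if j < ν then preLaw g else jointLaw f g (S j).1
    with hμ
  have hPμ : pathLaw f g ν S = Measure.infinitePi μ := rfl
  have hμj : ∀ j ≥ ν, μ j = jointLaw f g (S j).1 := fun j hj => if_neg (not_lt.2 hj)
  have hae : ∀ᵐ ω ∂(Measure.infinitePi μ), ∀ j ≥ ν,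
      mixRatio f g α (ω j) ≠ 0 ∧ mixRatio f g α (ω j) ≠ ∞ := by
    rw [ae_all_iff]
    intro j
    by_cases hj : j ≥ ν
    · have h1 := hr (S j)
      rw [← hμj j hj] at h1
      filter_upwards [(measurePreserving_eval_infinitePi μ j).quasiMeasurePreserving.ae h1]
        with ω hω _ using hω
    · exact ae_of_all _ fun ω h => absurd h hj
  have hsub : ∀ k : ℕ, ∀ᵐ ω ∂(Measure.infinitePi μ),
      ((ν + k : ℕ) : ℕ∞) < mCusumTime f g α b ω → ω ∈ walkBelow y b ν k := fun k => by
    filter_upwards [hae] with ω hω hlt n hn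
    rcases Nat.eq_zero_or_pos n with rfl | hn0
    · simpa using hb
    rw [lt_mCusumTime_iff] at hlt
    have h1 := hlt (ν + n) (by omega) (by omega)
    -- Of all starting points in the maximum, only the true changepoint is kept.
    have h2 : ∏ j ∈ Finset.Ico ν (ν + n), mixRatio f g α (ω j) ≤ mCusumStat f g α (ν + n) ω :=
      Finset.le_sup (f := fun i => ∏ j ∈ Finset.Ico i (ν + n), mixRatio f g α (ω j))
        (Finset.mem_range.2 (by omega))
    have h3 := lt_of_le_of_lt h2 h1
    rw [Finset.prod_Ico_eq_prod_range, Nat.add_sub_cancel_left] at h3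
    have h4 := (ENNReal.toReal_lt_toReal h3.ne_top ENNReal.ofReal_ne_top).2 h3
    rw [ENNReal.toReal_ofReal (Real.exp_pos _).le, ENNReal.toReal_prod] at h4
    have h5 : ∀ j ∈ Finset.range n, 0 < (mixRatio f g α (ω (ν + j))).toReal := fun j _ =>
      ENNReal.toReal_pos (hω _ (by omega)).1 (hω _ (by omega)).2
    rw [← Real.log_lt_iff_lt_exp (Finset.prod_pos h5), Real.log_prod fun j hj => (h5 j hj).ne'] at h4
    exact h4
  set B := A ∩ {ω | (ν : ℕ∞) < mCusumTime f g α b ω} with hB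
  have hBm : MeasurableSet[obsFiltration L ν] B :=
    hA.inter ((isDetectionTime_mCusumTime hf' hg').measurableSet_lt ν)
  have hle : ∀ k : ℕ, Measure.infinitePi μ
      (A ∩ {ω | ((ν + k : ℕ) : ℕ∞) < mCusumTime f g α b ω}) ≤
      Measure.infinitePi μ B * Measure.infinitePi μ (walkBelow y b ν k) := fun k => by
    rw [← (Indep_iff _ _ _).1 (indep_past_future μ ν) B _ hBm
      (measurableSet_walkBelow_future hym b ν k)]
    refine measure_mono_ae ?_
    filter_upwards [hsub k] with ω hω hmem
    exact ⟨⟨hmem.1, lt_of_le_of_lt (b := ((ν + k : ℕ) : ℕ∞))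
      (by exact_mod_cast Nat.le_add_right ν k) hmem.2⟩, hω hmem.2⟩
  rw [hPμ]
  calc _ ≤ ∑' k : ℕ, Measure.infinitePi μ B * Measure.infinitePi μ (walkBelow y b ν k) :=
        ENNReal.tsum_le_tsum hle
    _ = (∑' k : ℕ, Measure.infinitePi μ (walkBelow y b ν k)) * Measure.infinitePi μ B := by
        rw [ENNReal.tsum_mul_left, mul_comm]
    _ ≤ _ := by
        refine mul_le_mul' (le_trans ?_ (le_max_right _ _)) le_rfl
        refine tsum_measure_walkBelow_le μ hym hb.le hc ?_ ?_ ?_ ?_ hpos <;>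
          intro j hj <;> rw [hμj j hj]
        exacts [hy1 _, hy2 _, hI _, hM _]

end Delay

/-! ### Averaging over random paths: from paths to mixtures -/

section Averaging

variable {L m : ℕ} {f g : Fin L → ℝ → ℝ≥0} {τ : Obs L → ℕ∞}

/-- The event is decided by the first `ν + k` observations, so later anomalies can be erased; the
resulting law differs from the no-change law in `k` factors only and has a density. -/
theorem pathLaw_lt_eq (hf : ∀ l, IsPdf (f l)) (hg : ∀ l, IsPdf (g l))
    (hI : ∀ α : PMF (Placement L m), klNumber f g α < ∞) (hτ : IsDetectionTime τ)
    (ν k : ℕ) (S : AnomalyPath L m) :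
    pathLaw f g ν S {ω | ((ν + k : ℕ) : ℕ∞) < τ ω} =
      ∫⁻ ω in {ω | ((ν + k : ℕ) : ℕ∞) < τ ω},
        ∏ j ∈ Finset.range k, jointRatio f g (S (ν + j)).1 (ω (ν + j)) ∂(noChangeLaw g) := by
  have hf' := fun l => (hf l).1
  have hg' := fun l => (hg l).1
  have := isProbabilityMeasure_pathLaw_coord hf hg ν S
  have := isProbabilityMeasure_preLaw hg
  have hp : ∀ j, IsProbabilityMeasure
      (if j ∈ Finset.Ico ν (ν + k) then jointLaw f g (S j).1 else preLaw g) := fun j => by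
    split_ifs
    exacts [isProbabilityMeasure_jointLaw hf hg _, inferInstance]
  have hm := hτ.measurableSet_lt (ν + k)
  rw [pathLaw, infinitePi_apply_congr_past _ (k := ν + k) (fun j hj => ?_) hm (μ' := fun j =>
      if j ∈ Finset.Ico ν (ν + k) then jointLaw f g (S j).1 else preLaw g)]
  · rw [infinitePi_withDensity_prod (fun _ => preLaw g) (Finset.Ico ν (ν + k))
      (v := fun j => jointRatio f g (S j).1) (fun j => measurable_jointRatio hf' hg' _)
      (fun j hj => by rw [if_pos hj, jointLaw_eq_withDensity hf' hg' (hI _)])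
      (fun j hj => if_neg hj), withDensity_apply _ ((obsFiltration L).le _ _ hm)]
    simp_rw [Finset.prod_Ico_eq_prod_range, Nat.add_sub_cancel_left]
    rfl
  · by_cases h : j < ν
    · rw [if_pos h, if_neg (by simp; omega)]
    · rw [if_neg h, if_pos (by simp; omega)]

/-- The expectation over an i.i.d. sample of length `h` of a product of functions of single draws.
Draws from `k` on contribute the factor one, so a single sample space serves all `k ≤ h`. -/
theorem sum_pmf_mul_prod {ι : Type*} [Fintype ι] [DecidableEq ι] (α : PMF ι)
    (q : ι → ℕ → ℝ≥0∞) {k h : ℕ} (hk : k ≤ h) :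
    ∑ s : Fin h → ι, (∏ i, α (s i)) * ∏ j : Fin h, (if (j : ℕ) < k then q (s j) j else 1) =
      ∏ j ∈ Finset.range k, ∑ E, α E * q E j := by
  have h1 := Finset.prod_univ_sum (fun _ : Fin h => (Finset.univ : Finset ι))
    (fun (j : Fin h) E => α E * if (j : ℕ) < k then q E j else 1)
  rw [Fintype.piFinset_univ] at h1
  simp_rw [← Finset.prod_mul_distrib]
  rw [← h1]
  have h2 : ∀ j : Fin h, (∑ E, α E * if (j : ℕ) < k then q E j else 1) =
      if (j : ℕ) < k then ∑ E, α E * q E j else 1 := fun j => by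
    split_ifs
    · rfl
    · simp only [mul_one]
      rw [← tsum_fintype (L := .unconditional _)]
      exact α.tsum_coe
  rw [Finset.prod_congr rfl fun j _ => h2 j,
    Fin.prod_univ_eq_prod_range (fun j => if j < k then ∑ E, α E * q E j else 1) h]
  rw [← Finset.prod_filter]
  congr 1
  ext j
  simp only [Finset.mem_filter, Finset.mem_range]
  omega

/-- Every path obeys the delay bound, hence so does their average under i.i.d. placements, for which
the product of ratios averages to the product of mixture ratios. Truncating the delay at `h` steps
keeps the average a finite sum. -/
theorem sum_setLIntegral_prod_mixRatio_le (hf : ∀ l, IsPdf (f l)) (hg : ∀ l, IsPdf (g l))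
    (hI : ∀ α : PMF (Placement L m), klNumber f g α < ∞) (hτ : IsDetectionTime τ)
    (α : PMF (Placement L m)) (ν h : ℕ) :
    ∑ k ∈ Finset.range h, ∫⁻ ω in {ω | ((ν + k : ℕ) : ℕ∞) < τ ω},
        ∏ j ∈ Finset.range k, mixRatio f g α (ω (ν + j)) ∂(noChangeLaw g) ≤
      wadd m f g τ * noChangeLaw g {ω | (ν : ℕ∞) < τ ω} := by
  classical
  have hf' := fun l => (hf l).1
  have hg' := fun l => (hg l).1
  set P := noChangeLaw g with hP
  obtain ⟨E₀, -⟩ := α.support_nonempty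
  -- Only the times from `ν` to `ν + h - 1` matter. The values elsewhere, including those produced
  -- by the truncated subtraction for `j < ν`, are fillers.
  let path : (Fin h → Placement L m) → AnomalyPath L m := fun s j =>
    if hj : j - ν < h then s ⟨j - ν, hj⟩ else E₀
  have hpath : ∀ (s : Fin h → Placement L m) (j : Fin h), path s (ν + j) = s j := fun s j => by
    simp [path]
  have h0 : ∀ s, pathLaw f g ν (path s) {ω | (ν : ℕ∞) < τ ω} = P {ω | (ν : ℕ∞) < τ ω} :=
    fun s => by
      have := pathLaw_lt_eq hf hg hI hτ ν 0 (path s)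
      simpa using this
  have h1 : ∀ s : Fin h → Placement L m, ∑ k ∈ Finset.range h,
      ∫⁻ ω in {ω | ((ν + k : ℕ) : ℕ∞) < τ ω}, ∏ j : Fin h,
        (if (j : ℕ) < k then jointRatio f g (s j).1 (ω (ν + j)) else 1) ∂P ≤
      wadd m f g τ * P {ω | (ν : ℕ∞) < τ ω} := fun s => by
    calc _ = ∑ k ∈ Finset.range h, pathLaw f g ν (path s) {ω | ((ν + k : ℕ) : ℕ∞) < τ ω} := by
          refine Finset.sum_congr rfl fun k hk => ?_
          rw [pathLaw_lt_eq hf hg hI hτ]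
          refine lintegral_congr fun ω => ?_
          simp_rw [← hpath s]
          rw [Fin.prod_univ_eq_prod_range (fun j => if j < k then
            jointRatio f g (path s (ν + j)).1 (ω (ν + j)) else 1) h, ← Finset.prod_filter]
          congr 1
          ext j
          have := Finset.mem_range.1 hk
          simp only [Finset.mem_filter, Finset.mem_range]
          omega
      _ ≤ ∑' k : ℕ, pathLaw f g ν (path s) {ω | ((ν + k : ℕ) : ℕ∞) < τ ω} :=
          ENNReal.sum_le_tsum _
      _ ≤ _ := tsum_le_worstDelay_mul hf hg hτ
      _ ≤ _ := by
          rw [h0]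
          gcongr
          exact le_iSup₂ (f := fun S ν => worstDelay f g τ ν S) (path s) ν
  have hmeas : ∀ (k : ℕ) (s : Fin h → Placement L m), Measurable fun ω : Obs L => ∏ j : Fin h,
      (if (j : ℕ) < k then jointRatio f g (s j).1 (ω (ν + j)) else 1) := fun k s => by
    refine Finset.measurable_fun_prod _ fun j _ => ?_
    split_ifs
    · exact (measurable_jointRatio hf' hg' _).comp (measurable_pi_apply _)
    · exact measurable_const
  have hw : ∑ s : Fin h → Placement L m, ∏ i, α (s i) = 1 := by
    have := sum_pmf_mul_prod α (fun _ _ => 1) (Nat.zero_le h)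
    simpa using this
  calc _ = ∑ k ∈ Finset.range h, ∑ s : Fin h → Placement L m, (∏ i, α (s i)) *
        ∫⁻ ω in {ω | ((ν + k : ℕ) : ℕ∞) < τ ω}, ∏ j : Fin h,
          (if (j : ℕ) < k then jointRatio f g (s j).1 (ω (ν + j)) else 1) ∂P := by
        refine Finset.sum_congr rfl fun k hk => ?_
        simp_rw [mixRatio_eq_sum, ← lintegral_const_mul _ (hmeas k _)]
        rw [← lintegral_finsetSum _ fun s _ => (hmeas k s).const_mul _]
        refine lintegral_congr fun ω => ?_
        exact (sum_pmf_mul_prod α (fun E j => jointRatio f g E.1 (ω (ν + j)))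
          (Finset.mem_range.1 hk).le).symm
    _ = ∑ s : Fin h → Placement L m, (∏ i, α (s i)) * ∑ k ∈ Finset.range h,
        ∫⁻ ω in {ω | ((ν + k : ℕ) : ℕ∞) < τ ω}, ∏ j : Fin h,
          (if (j : ℕ) < k then jointRatio f g (s j).1 (ω (ν + j)) else 1) ∂P := by
        rw [Finset.sum_comm]
        simp_rw [Finset.mul_sum]
    _ ≤ ∑ s : Fin h → Placement L m, (∏ i, α (s i)) *
        (wadd m f g τ * P {ω | (ν : ℕ∞) < τ ω}) := by
        gcongr with s _
        exact h1 s
    _ = _ := by rw [← Finset.sum_mul, hw, one_mul]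

end Averaging

/-! ### The relative entropy needed for detection -/

section InformationBound

variable {L : ℕ}

/-- The product of `R` over the `k` observations that follow time `ν`. -/
noncomputable def lrProd (R : (Fin L → ℝ) → ℝ) (ν k : ℕ) (ω : Obs L) : ℝ :=
  ∏ j ∈ Finset.range k, R (ω (ν + j))

theorem lrProd_succ (R : (Fin L → ℝ) → ℝ) (ν k : ℕ) (ω : Obs L) :
    lrProd R ν (k + 1) ω = lrProd R ν k ω * R (ω (ν + k)) :=
  Finset.prod_range_succ _ _

variable {R : (Fin L → ℝ) → ℝ} {ν : ℕ}

theorem measurable_lrProd (hR : Measurable R) (k : ℕ) :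
    Measurable[obsFiltration L (ν + k)] (lrProd R ν k) :=
  Finset.measurable_fun_prod _ fun j hj => hR.comp (measurable_coord_past (by
    have := Finset.mem_range.1 hj; omega))

theorem lrProd_nonneg (hR : ∀ x, 0 ≤ R x) (k : ℕ) (ω : Obs L) : 0 ≤ lrProd R ν k ω :=
  Finset.prod_nonneg fun _ _ => hR _

theorem mul_mul_log_mul (a b : ℝ) :
    a * b * Real.log (a * b) = a * Real.log a * b + a * (b * Real.log b) := by
  have := Real.negMulLog_mul a b
  simp only [Real.negMulLog] at this
  linarith

/-- The tangent line of the convex function `x * log x` at `c`. -/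
theorem le_mul_log {x c : ℝ} (hx : 0 ≤ x) (hc : 0 < c) :
    x * Real.log c + x - c ≤ x * Real.log x := by
  rcases hx.eq_or_lt with rfl | hx
  · simp; exact hc.le
  · have h1 := Real.log_le_sub_one_of_pos (div_pos hc hx)
    rw [Real.log_div hc.ne' hx.ne'] at h1
    have h2 := mul_le_mul_of_nonneg_left h1 hx.le
    have h3 : x * (c / x - 1) = c - x := by field_simp
    linarith

variable {G : Measure (Fin L → ℝ)} [IsProbabilityMeasure G]

theorem integrable_lrProd (hR : Measurable R) (hRi : Integrable R G) (k : ℕ) :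
    Integrable (lrProd R ν k) (Measure.infinitePi fun _ => G) := by
  induction k with
  | zero => exact (integrable_const (1 : ℝ)).congr (ae_of_all _ fun ω => by simp [lrProd])
  | succ k ih =>
    have h := integrable_past_mul_coord (fun _ => G) (ν + k) (measurable_lrProd hR k) hR ih hRi
    exact h.congr (ae_of_all _ fun ω => (lrProd_succ R ν k ω).symm)

theorem integrable_lrProd_mul_log (hR : Measurable R) (hRi : Integrable R G)
    (hRl : Integrable (fun x => R x * Real.log (R x)) G) (k : ℕ) :
    Integrable (fun ω => lrProd R ν k ω * Real.log (lrProd R ν k ω))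
      (Measure.infinitePi fun _ => G) := by
  induction k with
  | zero => simp [lrProd]
  | succ k ih =>
    have h1 := integrable_past_mul_coord (fun _ => G) (ν + k)
      ((measurable_lrProd (ν := ν) hR k).mul (measurable_lrProd hR k).log) hR ih hRi
    have h2 := integrable_past_mul_coord (fun _ => G) (ν + k) (measurable_lrProd hR k)
      (hR.mul hR.log) (integrable_lrProd hR hRi k) hRl
    refine (h1.add h2).congr (ae_of_all _ fun ω => ?_)
    simp only [Pi.add_apply, Pi.mul_apply]
    rw [lrProd_succ, mul_mul_log_mul]

theorem setIntegral_past_mul_coord {k : ℕ} {B : Set (Obs L)}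
    (hB : MeasurableSet[obsFiltration L k] B) {u : Obs L → ℝ} {v : (Fin L → ℝ) → ℝ}
    (hu : Measurable[obsFiltration L k] u) (hv : Measurable v) :
    ∫ ω in B, u ω * v (ω k) ∂(Measure.infinitePi fun _ => G) =
      (∫ ω in B, u ω ∂(Measure.infinitePi fun _ => G)) * ∫ x, v x ∂G := by
  have hBm := (obsFiltration L).le _ _ hB
  rw [← integral_indicator hBm, ← integral_indicator hBm,
    ← integral_past_mul_coord (fun _ => G) k (hu.indicator hB) hv]
  congr 1
  ext ω
  by_cases h : ω ∈ B <;> simp [h]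

theorem setIntegral_lrProd_succ (hR : Measurable R) (hR1 : ∫ x, R x ∂G = 1) {k : ℕ}
    {B : Set (Obs L)} (hB : MeasurableSet[obsFiltration L (ν + k)] B) :
    ∫ ω in B, lrProd R ν (k + 1) ω ∂(Measure.infinitePi fun _ => G) =
      ∫ ω in B, lrProd R ν k ω ∂(Measure.infinitePi fun _ => G) := by
  simp_rw [lrProd_succ]
  rw [setIntegral_past_mul_coord hB (measurable_lrProd hR k) hR, hR1, mul_one]

theorem setIntegral_lrProd_mul_log_succ (hR : Measurable R) (hRi : Integrable R G)
    (hRl : Integrable (fun x => R x * Real.log (R x)) G) (hR1 : ∫ x, R x ∂G = 1) {k : ℕ}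
    {B : Set (Obs L)} (hB : MeasurableSet[obsFiltration L (ν + k)] B) :
    ∫ ω in B, lrProd R ν (k + 1) ω * Real.log (lrProd R ν (k + 1) ω)
        ∂(Measure.infinitePi fun _ => G) =
      ∫ ω in B, lrProd R ν k ω * Real.log (lrProd R ν k ω) ∂(Measure.infinitePi fun _ => G) +
      (∫ ω in B, lrProd R ν k ω ∂(Measure.infinitePi fun _ => G)) *
        ∫ x, R x * Real.log (R x) ∂G := by
  have hml := (measurable_lrProd (ν := ν) hR k).mul (measurable_lrProd (ν := ν) hR k).log
  have h1 := integrable_past_mul_coord (fun _ => G) (ν + k) hml hR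
    (integrable_lrProd_mul_log hR hRi hRl k) hRi
  have h2 := integrable_past_mul_coord (fun _ => G) (ν + k) (measurable_lrProd (ν := ν) hR k)
    (hR.mul hR.log) (integrable_lrProd hR hRi k) hRl
  simp_rw [lrProd_succ, mul_mul_log_mul]
  refine (integral_add h1.integrableOn h2.integrableOn).trans ?_
  rw [setIntegral_past_mul_coord hB hml hR, hR1, mul_one,
    setIntegral_past_mul_coord hB (measurable_lrProd hR k) (hR.mul hR.log)]
  rfl

theorem le_setIntegral_mul_log {Ω : Type*} [MeasurableSpace Ω] {P : Measure Ω}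
    [IsFiniteMeasure P] {Y : Ω → ℝ} (hY : ∀ ω, 0 ≤ Y ω) (hYi : Integrable Y P)
    (hYl : Integrable (fun ω => Y ω * Real.log (Y ω)) P) {c : ℝ} (hc : 0 < c) (B : Set Ω) :
    (∫ ω in B, Y ω ∂P) * (Real.log c + 1) - c * P.real B ≤
      ∫ ω in B, Y ω * Real.log (Y ω) ∂P := by
  have h1 : ∫ ω in B, (Y ω * (Real.log c + 1) - c) ∂P ≤ ∫ ω in B, Y ω * Real.log (Y ω) ∂P :=
    integral_mono ((hYi.integrableOn.mul_const _).sub (integrable_const c)) hYl.integrableOn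
      fun ω => by
        have := le_mul_log (hY ω) hc
        simp only
        linarith
  rw [integral_sub (hYi.integrableOn.mul_const _) (integrable_const c), integral_mul_const,
    setIntegral_const, smul_eq_mul, mul_comm (P.real B)] at h1
  exact h1

variable {τ : Obs L → ℕ∞}

theorem setIntegral_lt_eq_add (hτ : IsDetectionTime τ) {P : Measure (Obs L)} (n : ℕ)
    {Y : Obs L → ℝ} (hY : Integrable Y P) :
    ∫ ω in {ω | (n : ℕ∞) < τ ω}, Y ω ∂P =
      ∫ ω in {ω | ((n + 1 : ℕ) : ℕ∞) < τ ω}, Y ω ∂P +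
        ∫ ω in {ω | τ ω = ((n + 1 : ℕ) : ℕ∞)}, Y ω ∂P := by
  rw [setOf_lt_eq_union τ n, setIntegral_union (disjoint_lt_eq τ _)
    ((obsFiltration L).le _ _ (hτ.measurableSet_eq_succ n)) hY.integrableOn hY.integrableOn]

theorem setIntegral_lrProd_lt_succ_le (hR : Measurable R) (hR0 : ∀ x, 0 ≤ R x)
    (hRi : Integrable R G) (hR1 : ∫ x, R x ∂G = 1) (hτ : IsDetectionTime τ) (k : ℕ) :
    ∫ ω in {ω | ((ν + (k + 1) : ℕ) : ℕ∞) < τ ω}, lrProd R ν (k + 1) ω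
        ∂(Measure.infinitePi fun _ => G) ≤
      ∫ ω in {ω | ((ν + k : ℕ) : ℕ∞) < τ ω}, lrProd R ν k ω ∂(Measure.infinitePi fun _ => G) := by
  rw [← setIntegral_lrProd_succ (k := k) hR hR1 (hτ.measurableSet_lt _),
    setIntegral_lt_eq_add hτ (ν + k) (integrable_lrProd hR hRi _)]
  have h : 0 ≤ ∫ ω in {ω | τ ω = ((ν + k + 1 : ℕ) : ℕ∞)}, lrProd R ν (k + 1) ω
      ∂(Measure.infinitePi fun _ => G) := integral_nonneg fun ω => lrProd_nonneg hR0 _ ω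
  exact le_add_of_nonneg_right h

/-- With `R` a likelihood ratio, the integral of `lrProd R ν k` over `τ > ν + k` is the probability
of that event when the change occurs at `ν`. Entropy enters at rate `∫ R log R` per surviving step,
and the part that leaves by stopping is bounded below by the tangent inequality at `c`. Stopping
after the change thus costs `log c` per unit of probability, up to `c` times the no-change
probability of stopping. -/
theorem sub_mul_log_le (hR : Measurable R) (hR0 : ∀ x, 0 ≤ R x) (hRi : Integrable R G)
    (hRl : Integrable (fun x => R x * Real.log (R x)) G) (hR1 : ∫ x, R x ∂G = 1)
    (hτ : IsDetectionTime τ) {c : ℝ} (hc : 0 < c) (h : ℕ) :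
    ((Measure.infinitePi fun _ => G).real {ω | (ν : ℕ∞) < τ ω} -
        ∫ ω in {ω | ((ν + h : ℕ) : ℕ∞) < τ ω}, lrProd R ν h ω
          ∂(Measure.infinitePi fun _ => G)) * Real.log c ≤
      (∫ x, R x * Real.log (R x) ∂G) * ∑ k ∈ Finset.range h,
        ∫ ω in {ω | ((ν + k : ℕ) : ℕ∞) < τ ω}, lrProd R ν k ω ∂(Measure.infinitePi fun _ => G) +
      c * ∑ k ∈ Finset.range h,
        (Measure.infinitePi fun _ => G).real {ω | τ ω = ((ν + k + 1 : ℕ) : ℕ∞)} := by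
  set P := Measure.infinitePi fun _ : ℕ => G with hP
  set I := ∫ x, R x * Real.log (R x) ∂G with hI
  set a : ℕ → ℝ := fun k => ∫ ω in {ω | ((ν + k : ℕ) : ℕ∞) < τ ω}, lrProd R ν k ω ∂P with ha
  set Z : ℕ → ℝ := fun k => ∫ ω in {ω | ((ν + k : ℕ) : ℕ∞) < τ ω},
    lrProd R ν k ω * Real.log (lrProd R ν k ω) ∂P with hZ
  have key : ∀ n : ℕ, Z n + (a 0 - a n) * (Real.log c + 1) ≤ I * ∑ k ∈ Finset.range n, a k +
      c * ∑ k ∈ Finset.range n, P.real {ω | τ ω = ((ν + k + 1 : ℕ) : ℕ∞)} := by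
    intro n
    induction n with
    | zero => simp [hZ, lrProd]
    | succ n ih =>
      have e1 : a n = a (n + 1) +
          ∫ ω in {ω | τ ω = ((ν + n + 1 : ℕ) : ℕ∞)}, lrProd R ν (n + 1) ω ∂P := by
        simp only [ha]
        rw [← setIntegral_lrProd_succ hR hR1 (hτ.measurableSet_lt _),
          setIntegral_lt_eq_add hτ _ (integrable_lrProd hR hRi _)]
        rfl
      have e2 : Z n + a n * I = Z (n + 1) + ∫ ω in {ω | τ ω = ((ν + n + 1 : ℕ) : ℕ∞)},
          lrProd R ν (n + 1) ω * Real.log (lrProd R ν (n + 1) ω) ∂P := by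
        simp only [ha, hZ, hI]
        rw [← setIntegral_lrProd_mul_log_succ hR hRi hRl hR1 (hτ.measurableSet_lt _),
          setIntegral_lt_eq_add hτ _ (integrable_lrProd_mul_log hR hRi hRl _)]
        rfl
      have e3 := le_setIntegral_mul_log (lrProd_nonneg hR0 (n + 1))
        (integrable_lrProd (G := G) (ν := ν) hR hRi _) (integrable_lrProd_mul_log hR hRi hRl _) hc
        {ω | τ ω = ((ν + n + 1 : ℕ) : ℕ∞)}
      rw [Finset.sum_range_succ, Finset.sum_range_succ]
      have e4 : (a n - a (n + 1)) * (Real.log c + 1) -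
          c * P.real {ω | τ ω = ((ν + n + 1 : ℕ) : ℕ∞)} ≤ Z n + a n * I - Z (n + 1) := by
        rw [e2, e1]
        ring_nf at e3 ⊢
        linarith
      linarith
  have h0 : a 0 = P.real {ω | (ν : ℕ∞) < τ ω} := by
    simp [ha, lrProd]
  -- For the survivors the tangent at `1` is used: their entropy is at least `a h - a 0`, which
  -- cancels the `+ 1` next to `log c` in `key`.
  have hZh := le_setIntegral_mul_log (lrProd_nonneg hR0 h)
    (integrable_lrProd (G := G) (ν := ν) hR hRi _) (integrable_lrProd_mul_log hR hRi hRl _)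
    one_pos {ω | ((ν + h : ℕ) : ℕ∞) < τ ω}
  rw [Real.log_one, zero_add, mul_one, one_mul] at hZh
  have hmono : P.real {ω | ((ν + h : ℕ) : ℕ∞) < τ ω} ≤ P.real {ω | (ν : ℕ∞) < τ ω} :=
    measureReal_mono fun ω (hω : ((ν + h : ℕ) : ℕ∞) < τ ω) =>
      lt_of_le_of_lt (b := ((ν + h : ℕ) : ℕ∞)) (by exact_mod_cast Nat.le_add_right ν h) hω
  have := key h
  rw [h0] at this
  change a h - _ ≤ Z h at hZh
  change (_ - a h) * _ ≤ _
  linarith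

/-- If every `ν` failed, summation over `ν` would give `(2 * h / γ) * E[τ] ≤ h`, as each value of
`τ` lies in at most `h` windows. But the left side is at least `2 * h`. -/
theorem exists_sum_measure_eq_le (hτ : IsDetectionTime τ) {P : Measure (Obs L)}
    [IsProbabilityMeasure P] {γ : ℝ} (hγ : 0 < γ)
    (hle : ENNReal.ofReal γ ≤ ∫⁻ ω, (τ ω : ℝ≥0∞) ∂P) {h : ℕ} (hh : 1 ≤ h) :
    ∃ ν : ℕ, 0 < P.real {ω | (ν : ℕ∞) < τ ω} ∧
      ∑ k ∈ Finset.range h, P.real {ω | τ ω = ((ν + k + 1 : ℕ) : ℕ∞)} ≤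
        2 * h / γ * P.real {ω | (ν : ℕ∞) < τ ω} := by
  by_contra! hcon
  have h1 : ∀ ν : ℕ, ENNReal.ofReal (2 * h / γ) * P {ω | (ν : ℕ∞) < τ ω} ≤
      ∑ k ∈ Finset.range h, P {ω | τ ω = ((ν + k + 1 : ℕ) : ℕ∞)} := fun ν => by
    rcases (measureReal_nonneg (μ := P) (s := {ω | (ν : ℕ∞) < τ ω})).eq_or_lt with h0 | h0
    · rw [(measureReal_eq_zero_iff).1 h0.symm, mul_zero]
      exact zero_le
    · have h2 := ENNReal.ofReal_le_ofReal (hcon ν h0).le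
      rw [ENNReal.ofReal_mul (by positivity), ofReal_measureReal,
        ENNReal.ofReal_sum_of_nonneg fun _ _ => measureReal_nonneg] at h2
      exact h2.trans_eq (Finset.sum_congr rfl fun k _ => ofReal_measureReal)
  have h2 : ∑' ν : ℕ, ∑ k ∈ Finset.range h, P {ω | τ ω = ((ν + k + 1 : ℕ) : ℕ∞)} ≤ h := by
    rw [Summable.tsum_finsetSum fun _ _ => ENNReal.summable]
    calc _ ≤ ∑ k ∈ Finset.range h, (1 : ℝ≥0∞) := by
          refine Finset.sum_le_sum fun k _ => ?_
          refine (tsum_meas_le_meas_iUnion_of_disjoint P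
            (fun ν => (obsFiltration L).le _ _ (hτ.measurableSet_eq_succ (ν + k))) ?_).trans
            prob_le_one
          intro i j hij
          refine Set.disjoint_left.2 fun ω h1 h2 => hij ?_
          have h3 := Eq.trans (Eq.symm (h1 : τ ω = _)) (h2 : τ ω = _)
          have h4 : i + k + 1 = j + k + 1 := by exact_mod_cast h3
          omega
      _ = h := by simp
  have h3 := (ENNReal.tsum_le_tsum h1).trans h2
  rw [ENNReal.tsum_mul_left, ← lintegral_eq_tsum hτ] at h3
  have h4 := (mul_le_mul' (le_refl (ENNReal.ofReal (2 * h / γ))) hle).trans h3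
  rw [← ENNReal.ofReal_mul (by positivity), div_mul_cancel₀ _ hγ.ne', ← ENNReal.ofReal_natCast h,
    ENNReal.ofReal_le_ofReal_iff (by positivity)] at h4
  have : (1 : ℝ) ≤ h := by exact_mod_cast hh
  linarith

end InformationBound

/-! ### Lower bound on the delay of an arbitrary test -/

section LowerBound

variable {L m : ℕ} {f g : Fin L → ℝ → ℝ≥0} {τ : Obs L → ℕ∞}

theorem log_sub_one_le_wadd_mul (hf : ∀ l, IsPdf (f l)) (hg : ∀ l, IsPdf (g l))
    (hI : ∀ α : PMF (Placement L m), klNumber f g α < ∞) (α : PMF (Placement L m))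
    (hfin : ∀ᵐ x ∂(preLaw g), mixRatio f g α x ≠ ∞)
    (hRi : Integrable (fun x => (mixRatio f g α x).toReal) (preLaw g))
    (hR1 : ∫ x, (mixRatio f g α x).toReal ∂(preLaw g) = 1)
    (hRl : Integrable (fun x => (mixRatio f g α x).toReal * Real.log (mixRatio f g α x).toReal)
      (preLaw g))
    {I : ℝ} (hRI : ∫ x, (mixRatio f g α x).toReal * Real.log (mixRatio f g α x).toReal
      ∂(preLaw g) = I) (hI0 : 0 ≤ I)
    {γ : ℝ} (hτ : τ ∈ stoppingClass g γ) (htop : wadd m f g τ ≠ ∞) {h : ℕ} (hh : 1 ≤ h)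
    (hγ : 2 * h ≤ γ) :
    Real.log (γ / (2 * h)) - 1 ≤
      (wadd m f g τ).toReal * (I + Real.log (γ / (2 * h)) / h) := by
  have hf' := fun l => (hf l).1
  have hg' := fun l => (hg l).1
  have := isProbabilityMeasure_preLaw hg
  set G := preLaw g with hG
  set R : (Fin L → ℝ) → ℝ := fun x => (mixRatio f g α x).toReal with hR
  have hRm : Measurable R := (measurable_mixRatio hf' hg' α).ennreal_toReal
  have hR0 : ∀ x, 0 ≤ R x := fun x => ENNReal.toReal_nonneg
  have hh' : (1 : ℝ) ≤ h := by exact_mod_cast hh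
  have hγ0 : 0 < γ := by linarith
  obtain ⟨hτ, hmt⟩ := hτ
  obtain ⟨ν, hν, hsum⟩ := exists_sum_measure_eq_le hτ (P := Measure.infinitePi fun _ => G) hγ0
    hmt hh
  set P := Measure.infinitePi fun _ : ℕ => G with hP
  set p := P.real {ω | (ν : ℕ∞) < τ ω} with hp
  set D := (wadd m f g τ).toReal with hD
  set a : ℕ → ℝ := fun k => ∫ ω in {ω | ((ν + k : ℕ) : ℕ∞) < τ ω}, lrProd R ν k ω ∂P with ha
  have ha_lint : ∀ k, ENNReal.ofReal (a k) = ∫⁻ ω in {ω | ((ν + k : ℕ) : ℕ∞) < τ ω},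
      ∏ j ∈ Finset.range k, mixRatio f g α (ω (ν + j)) ∂P := fun k => by
    simp only [ha]
    rw [ofReal_integral_eq_lintegral_ofReal (integrable_lrProd hRm hRi k).integrableOn
      (ae_of_all _ fun ω => lrProd_nonneg hR0 k ω)]
    refine lintegral_congr_ae (ae_restrict_of_ae ?_)
    have hae : ∀ᵐ ω ∂P, ∀ j, mixRatio f g α (ω j) ≠ ∞ := ae_all_iff.2 fun j =>
      (measurePreserving_eval_infinitePi (fun _ => G) j).quasiMeasurePreserving.ae hfin
    filter_upwards [hae] with ω hω
    rw [lrProd, ENNReal.ofReal_prod_of_nonneg fun _ _ => hR0 _]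
    exact Finset.prod_congr rfl fun j _ => ENNReal.ofReal_toReal (hω _)
  have ha0 : ∀ k, 0 ≤ a k := fun k => integral_nonneg fun ω => lrProd_nonneg hR0 k ω
  have hsumD : ∑ k ∈ Finset.range h, a k ≤ D * p := by
    have h1 := sum_setLIntegral_prod_mixRatio_le hf hg hI hτ α ν h
    have h2 : ENNReal.ofReal (∑ k ∈ Finset.range h, a k) ≤ ENNReal.ofReal (D * p) := by
      rw [ENNReal.ofReal_sum_of_nonneg fun k _ => ha0 k,
        ENNReal.ofReal_mul ENNReal.toReal_nonneg, ENNReal.ofReal_toReal htop, hp,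
        ofReal_measureReal]
      simp_rw [ha_lint]
      exact h1
    exact (ENNReal.ofReal_le_ofReal_iff (by positivity)).1 h2
  have hanti : Antitone a := antitone_nat_of_succ_le fun k =>
    setIntegral_lrProd_lt_succ_le hRm hR0 hRi hR1 hτ k
  -- Markov's inequality for the truncated delay: survival for the whole window has probability at
  -- most `D / h` relative to `p`.
  have hah : h * a h ≤ D * p := by
    refine le_trans ?_ hsumD
    calc h * a h = ∑ _k ∈ Finset.range h, a h := by simp
      _ ≤ _ := Finset.sum_le_sum fun k hk => hanti (Finset.mem_range.1 hk).le
  -- The tangent point `γ / (2 * h)` is the reciprocal of the window bound, so the false-alarm term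
  -- costs at most `p`.
  have hc : 0 < γ / (2 * h) := by positivity
  have hlog : 0 ≤ Real.log (γ / (2 * h)) := Real.log_nonneg (by
    rw [le_div_iff₀ (by positivity)]; linarith)
  have hmain := sub_mul_log_le (ν := ν) hRm hR0 hRi hRl hR1 hτ hc h
  rw [hRI] at hmain
  change (p - a h) * _ ≤ I * ∑ k ∈ Finset.range h, a k + _ at hmain
  have h1 : γ / (2 * h) * ∑ k ∈ Finset.range h, P.real {ω | τ ω = ((ν + k + 1 : ℕ) : ℕ∞)} ≤ p := by
    calc _ ≤ γ / (2 * h) * (2 * h / γ * p) := mul_le_mul_of_nonneg_left hsum hc.le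
      _ = p := by field_simp
  have h2 := mul_le_mul_of_nonneg_left hsumD hI0
  have h3 : a h ≤ D * p / h := by rw [le_div_iff₀ (by positivity)]; linarith
  have h4 := mul_le_mul_of_nonneg_right h3 hlog
  have h5 : p * (Real.log (γ / (2 * h)) - 1) ≤ p * (D * (I + Real.log (γ / (2 * h)) / h)) := by
    have : D * p / h * Real.log (γ / (2 * h)) = p * (D * (Real.log (γ / (2 * h)) / h)) := by
      field_simp
    rw [this] at h4
    linarith
  exact le_of_mul_le_mul_left h5 hν

end LowerBound

/-! ### First-order condition for the entropy minimizer -/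

section Variational

variable {X : Type*} [MeasurableSpace X] {G : Measure X} {R Q : X → ℝ}

/-- A pointwise Gibbs inequality: with `s` the mixture, `r * log s ≤ r * log r + (s - r)`. The
correction `s - r` has integral zero when `r` and `q` have equal mass. -/
theorem mul_log_mix_le {r q ε : ℝ} (hr : 0 ≤ r) (hq : 0 ≤ q) (hε : 0 ≤ ε) (hε1 : ε < 1) :
    ((1 - ε) * r + ε * q) * Real.log ((1 - ε) * r + ε * q) ≤
      (1 - ε) * (r * Real.log r + (((1 - ε) * r + ε * q) - r)) +
        ε * (q * Real.log ((1 - ε) * r + ε * q)) := by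
  have h1 : 0 < 1 - ε := by linarith
  have h2 : 0 ≤ ε * q := mul_nonneg hε hq
  have h3 : 0 ≤ (1 - ε) * r := mul_nonneg h1.le hr
  have key : r * Real.log ((1 - ε) * r + ε * q) ≤
      r * Real.log r + (((1 - ε) * r + ε * q) - r) := by
    rcases (add_nonneg h3 h2).eq_or_lt with h0 | h0
    · have : (1 - ε) * r = 0 := by linarith
      have hr0 : r = 0 := (mul_eq_zero.1 this).resolve_left h1.ne'
      rw [← h0, hr0]; simp
    · have := le_mul_log hr h0
      linarith
  have := mul_le_mul_of_nonneg_left key h1.le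
  linarith

/-- For `ε ≤ 1 / 2` the mixture lies between `r / 2` and `max r q`. This gives an envelope free of
`ε` for dominated convergence. -/
theorem abs_log_mix_le {r q ε : ℝ} (hr : 0 < r) (hq : 0 < q) (hε : 0 ≤ ε) (hε1 : ε ≤ 1 / 2) :
    |Real.log ((1 - ε) * r + ε * q)| ≤ |Real.log r| + |Real.log q| + Real.log 2 := by
  have h2 : 0 ≤ ε * q := mul_nonneg hε hq.le
  have hlow : r / 2 ≤ (1 - ε) * r + ε * q := by nlinarith
  have hpos : 0 < (1 - ε) * r + ε * q := by linarith [half_pos hr]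
  have hl1 := Real.log_le_log (half_pos hr) hlow
  rw [Real.log_div hr.ne' two_ne_zero] at hl1
  have hlog2 : 0 ≤ Real.log 2 := Real.log_nonneg (by norm_num)
  rw [abs_le]
  constructor
  · linarith [neg_abs_le (Real.log r), abs_nonneg (Real.log q)]
  · rcases le_total r q with h | h
    · have : (1 - ε) * r + ε * q ≤ q := by nlinarith
      linarith [Real.log_le_log hpos this, le_abs_self (Real.log q), abs_nonneg (Real.log r)]
    · have : (1 - ε) * r + ε * q ≤ r := by nlinarith
      linarith [Real.log_le_log hpos this, le_abs_self (Real.log r), abs_nonneg (Real.log q)]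

/-- No derivative is taken. For the mixture `S`, minimality and the Gibbs inequality give `∫ R log R
≤ (1 - ε) ∫ R log R + ε ∫ Q log S`; cancelling leaves `∫ R log R ≤ ∫ Q log S`, and then `ε → 0`. -/
theorem integral_mul_log_le_of_forall_mix (hR : Measurable R) (hQ : Measurable Q)
    (hR0 : ∀ x, 0 ≤ R x) (hQ0 : ∀ x, 0 ≤ Q x) (hRi : Integrable R G) (hQi : Integrable Q G)
    (hRQ : ∫ x, R x ∂G = ∫ x, Q x ∂G)
    (hRl : Integrable (fun x => R x * Real.log (R x)) G)
    (hQl : Integrable (fun x => Q x * Real.log (Q x)) G)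
    (hQRl : Integrable (fun x => Q x * Real.log (R x)) G)
    (hac : ∀ᵐ x ∂G, R x = 0 → Q x = 0)
    (hmin : ∀ ε : ℝ, 0 < ε → ε ≤ 1 / 2 →
      Integrable (fun x => ((1 - ε) * R x + ε * Q x) * Real.log ((1 - ε) * R x + ε * Q x)) G ∧
      ∫ x, R x * Real.log (R x) ∂G ≤
        ∫ x, ((1 - ε) * R x + ε * Q x) * Real.log ((1 - ε) * R x + ε * Q x) ∂G) :
    ∫ x, R x * Real.log (R x) ∂G ≤ ∫ x, Q x * Real.log (R x) ∂G := by
  set B : X → ℝ := fun x => |Q x * Real.log (R x)| + |Q x * Real.log (Q x)| + Q x * Real.log 2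
    with hB
  have hBi : Integrable B G := (hQRl.abs.add hQl.abs).add (hQi.mul_const _)
  have hbound : ∀ ε : ℝ, 0 ≤ ε → ε ≤ 1 / 2 → ∀ᵐ x ∂G,
      ‖Q x * Real.log ((1 - ε) * R x + ε * Q x)‖ ≤ B x := fun ε h0 h1 => by
    filter_upwards [hac] with x hx
    rcases (hQ0 x).eq_or_lt with hq | hq
    · simp [hB, ← hq]
    · have hr : 0 < R x := (hR0 x).lt_of_ne fun h => hq.ne' (hx h.symm)
      rw [Real.norm_eq_abs, hB]
      simp only [abs_mul, abs_of_pos hq]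
      rw [← mul_add, ← mul_add]
      exact mul_le_mul_of_nonneg_left (abs_log_mix_le hr hq h0 h1) hq.le
  have hmeas : ∀ ε : ℝ, AEStronglyMeasurable
      (fun x => Q x * Real.log ((1 - ε) * R x + ε * Q x)) G := fun ε =>
    (hQ.mul ((hR.const_mul _).add (hQ.const_mul _)).log).aestronglyMeasurable
  have hle : ∀ ε : ℝ, 0 < ε → ε ≤ 1 / 2 → ∫ x, R x * Real.log (R x) ∂G ≤
      ∫ x, Q x * Real.log ((1 - ε) * R x + ε * Q x) ∂G := fun ε h0 h1 => by
    obtain ⟨hi, hm⟩ := hmin ε h0 h1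
    have hQε : Integrable (fun x => Q x * Real.log ((1 - ε) * R x + ε * Q x)) G :=
      hBi.mono' (hmeas ε) (hbound ε h0.le h1)
    have hmix : Integrable (fun x => (1 - ε) * R x + ε * Q x) G :=
      (hRi.const_mul _).add (hQi.const_mul _)
    have hmixi : Integrable (fun x => ((1 - ε) * R x + ε * Q x) - R x) G := hmix.sub hRi
    have hRmix : Integrable (fun x => (1 - ε) * (R x * Real.log (R x) +
        (((1 - ε) * R x + ε * Q x) - R x))) G := (hRl.add hmixi).const_mul _
    have hmix0 : ∫ x, (((1 - ε) * R x + ε * Q x) - R x) ∂G = 0 := by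
      rw [integral_sub hmix hRi,
        integral_add (hRi.const_mul _) (hQi.const_mul _), integral_const_mul, integral_const_mul,
        ← hRQ]
      ring
    have h2 : ∫ x, ((1 - ε) * R x + ε * Q x) * Real.log ((1 - ε) * R x + ε * Q x) ∂G ≤
        ∫ x, ((1 - ε) * (R x * Real.log (R x) + (((1 - ε) * R x + ε * Q x) - R x)) +
          ε * (Q x * Real.log ((1 - ε) * R x + ε * Q x))) ∂G :=
      integral_mono hi (hRmix.add (hQε.const_mul _)) fun x =>
        mul_log_mix_le (hR0 x) (hQ0 x) h0.le (by linarith)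
    rw [integral_add hRmix (hQε.const_mul _), integral_const_mul,
      integral_const_mul, integral_add hRl hmixi, hmix0, add_zero] at h2
    have h3 : ε * ∫ x, R x * Real.log (R x) ∂G ≤
        ε * ∫ x, Q x * Real.log ((1 - ε) * R x + ε * Q x) ∂G := by linarith
    exact le_of_mul_le_mul_left h3 h0
  have hε : ∀ n : ℕ, 0 < 1 / ((n : ℝ) + 2) ∧ 1 / ((n : ℝ) + 2) ≤ 1 / 2 := fun n => by
    have : (0 : ℝ) ≤ n := n.cast_nonneg
    exact ⟨by positivity, one_div_le_one_div_of_le (by norm_num) (by linarith)⟩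
  have hε0 : Tendsto (fun n : ℕ => 1 / ((n : ℝ) + 2)) atTop (𝓝 0) :=
    tendsto_const_nhds.div_atTop (tendsto_natCast_atTop_atTop.atTop_add tendsto_const_nhds)
  have hlim : Tendsto (fun n : ℕ => ∫ x, Q x *
      Real.log ((1 - 1 / ((n : ℝ) + 2)) * R x + 1 / ((n : ℝ) + 2) * Q x) ∂G) atTop
      (𝓝 (∫ x, Q x * Real.log (R x) ∂G)) := by
    refine tendsto_integral_of_dominated_convergence B (fun n => hmeas _) hBi
      (fun n => hbound _ (hε n).1.le (hε n).2) ?_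
    filter_upwards [hac] with x hx
    rcases (hQ0 x).eq_or_lt with hq | hq
    · simp [← hq]
    · have hr : R x ≠ 0 := fun h => hq.ne' (hx h)
      refine Tendsto.const_mul _ (Tendsto.log ?_ hr)
      have h1 := ((hε0.const_sub 1).mul_const (R x)).add (hε0.mul_const (Q x))
      simpa using h1
  exact ge_of_tendsto hlim (Eventually.of_forall fun n => hle _ (hε n).1 (hε n).2)

end Variational

/-! ### Kullback–Leibler numbers of mixtures and the drift inequality -/

section KullbackLeibler

variable {L m : ℕ} {f g : Fin L → ℝ → ℝ≥0}

theorem lintegral_mixRatio (hf : ∀ l, IsPdf (f l)) (hg : ∀ l, IsPdf (g l))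
    {α : PMF (Placement L m)} (hI : klNumber f g α < ∞) :
    ∫⁻ x, mixRatio f g α x ∂(preLaw g) = 1 := by
  have h := (isProbabilityMeasure_mixLaw hf hg α).measure_univ
  rwa [mixLaw_eq_withDensity (fun l => (hf l).1) (fun l => (hg l).1) hI,
    withDensity_apply _ MeasurableSet.univ, setLIntegral_univ] at h

theorem mixRatio_ne_top_ae (hf : ∀ l, IsPdf (f l)) (hg : ∀ l, IsPdf (g l))
    {α : PMF (Placement L m)} (hI : klNumber f g α < ∞) :
    ∀ᵐ x ∂(preLaw g), mixRatio f g α x ≠ ∞ := by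
  have h := ae_lt_top (μ := preLaw g) (measurable_mixRatio (fun l => (hf l).1) (fun l => (hg l).1) α)
    (by rw [lintegral_mixRatio hf hg hI]; exact ENNReal.one_ne_top)
  filter_upwards [h] with x hx using hx.ne

theorem integrable_mixRatio (hf : ∀ l, IsPdf (f l)) (hg : ∀ l, IsPdf (g l))
    {α : PMF (Placement L m)} (hI : klNumber f g α < ∞) :
    Integrable (fun x => (mixRatio f g α x).toReal) (preLaw g) :=
  integrable_toReal_of_lintegral_ne_top
    (measurable_mixRatio (fun l => (hf l).1) (fun l => (hg l).1) α).aemeasurable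
    (by rw [lintegral_mixRatio hf hg hI]; exact ENNReal.one_ne_top)

theorem integral_mixRatio (hf : ∀ l, IsPdf (f l)) (hg : ∀ l, IsPdf (g l))
    {α : PMF (Placement L m)} (hI : klNumber f g α < ∞) :
    ∫ x, (mixRatio f g α x).toReal ∂(preLaw g) = 1 := by
  rw [integral_toReal (measurable_mixRatio (fun l => (hf l).1) (fun l => (hg l).1) α).aemeasurable
    ((mixRatio_ne_top_ae hf hg hI).mono fun x hx => hx.lt_top), lintegral_mixRatio hf hg hI,
    ENNReal.toReal_one]

theorem rnDeriv_mixLaw_ae_eq (hf : ∀ l, IsPdf (f l)) (hg : ∀ l, IsPdf (g l))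
    {α : PMF (Placement L m)} (hI : klNumber f g α < ∞) :
    (mixLaw f g α).rnDeriv (preLaw g) =ᵐ[preLaw g] mixRatio f g α := by
  have := isProbabilityMeasure_preLaw hg
  rw [mixLaw_eq_withDensity (fun l => (hf l).1) (fun l => (hg l).1) hI]
  exact Measure.rnDeriv_withDensity _
    (measurable_mixRatio (fun l => (hf l).1) (fun l => (hg l).1) α)

theorem integrable_mixRatio_mul_log (hf : ∀ l, IsPdf (f l)) (hg : ∀ l, IsPdf (g l))
    {α : PMF (Placement L m)} (hI : klNumber f g α < ∞) :
    Integrable (fun x => (mixRatio f g α x).toReal * Real.log (mixRatio f g α x).toReal)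
      (preLaw g) := by
  have := isProbabilityMeasure_preLaw hg
  have := isProbabilityMeasure_mixLaw hf hg α
  have := Measure.haveLebesgueDecomposition_of_sigmaFinite (mixLaw f g α) (preLaw g)
  obtain ⟨hac, hi⟩ := InformationTheory.klDiv_ne_top_iff.1 hI.ne
  refine ((integrable_rnDeriv_mul_log_iff hac).2 hi).congr ?_
  filter_upwards [rnDeriv_mixLaw_ae_eq hf hg hI] with x hx
  rw [hx]

theorem integral_mixRatio_mul_log (hf : ∀ l, IsPdf (f l)) (hg : ∀ l, IsPdf (g l))
    {α : PMF (Placement L m)} (hI : klNumber f g α < ∞) :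
    ∫ x, (mixRatio f g α x).toReal * Real.log (mixRatio f g α x).toReal ∂(preLaw g) =
      (klNumber f g α).toReal := by
  have := isProbabilityMeasure_preLaw hg
  have := isProbabilityMeasure_mixLaw hf hg α
  have := Measure.haveLebesgueDecomposition_of_sigmaFinite (mixLaw f g α) (preLaw g)
  rw [klNumber, InformationTheory.toReal_klDiv_of_measure_eq (mixLaw_ac hI) (by simp),
    ← integral_rnDeriv_smul (mixLaw_ac hI)]
  refine integral_congr_ae ?_
  filter_upwards [rnDeriv_mixLaw_ae_eq hf hg hI] with x hx
  rw [llr, hx, smul_eq_mul]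

/-- The law of `α` with probability `1 - ε` and the placement `E` with probability `ε`. -/
noncomputable def perturb (α : PMF (Placement L m)) (E : Placement L m) (ε : ℝ≥0∞) (hε : ε ≤ 1) :
    PMF (Placement L m) :=
  PMF.ofFintype (fun F => (1 - ε) * α F + ε * PMF.pure E F) (by
    have h : ∀ β : PMF (Placement L m), ∑ F, β F = 1 := fun β => by
      rw [← tsum_fintype (L := .unconditional _)]; exact β.tsum_coe
    rw [Finset.sum_add_distrib, ← Finset.mul_sum, ← Finset.mul_sum, h, h, mul_one, mul_one,
      tsub_add_cancel_of_le hε])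

theorem mixRatio_perturb (α : PMF (Placement L m)) (E : Placement L m) {ε : ℝ≥0∞} (hε : ε ≤ 1)
    (x : Fin L → ℝ) :
    mixRatio f g (perturb α E ε hε) x =
      (1 - ε) * mixRatio f g α x + ε * mixRatio f g (PMF.pure E) x := by
  simp only [mixRatio_eq_sum, perturb, PMF.ofFintype_apply, add_mul, Finset.sum_add_distrib,
    Finset.mul_sum, mul_assoc]

theorem abs_log_eq_ofReal {r : ℝ≥0∞} (h0 : r ≠ 0) (h1 : r ≠ ∞) :
    (ENNReal.log r).abs = ENNReal.ofReal |Real.log r.toReal| := by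
  rw [ENNReal.log, if_neg h0, if_neg h1]
  rfl

/-- The extended logarithm has infinite modulus at `0` and at `∞`, so a finite second moment
excludes both values almost surely. -/
theorem mixRatio_ne_zero_ae_of_secondMoment (hf : ∀ l, IsPdf (f l)) (hg : ∀ l, IsPdf (g l))
    {α : PMF (Placement L m)} {E : Placement L m} (h : secondMoment f g α E < ∞) :
    ∀ᵐ x ∂(jointLaw f g E.1), mixRatio f g α x ≠ 0 ∧ mixRatio f g α x ≠ ∞ := by
  have hm := measurable_mixRatio (fun l => (hf l).1) (fun l => (hg l).1) α
  have h1 := ae_lt_top' (f := fun x => (ENNReal.log (mixRatio f g α x)).abs ^ 2)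
    (μ := jointLaw f g E.1) (by
      have : Measurable EReal.abs := 
        EReal.measurable_of_measurable_real (measurable_norm.ennreal_ofReal)
      exact ((this.comp (ENNReal.measurable_log.comp hm)).pow_const 2).aemeasurable) h.ne
  filter_upwards [h1] with x hx
  constructor <;> intro h0 <;> simp [h0] at hx

theorem integrable_log_sq_of_secondMoment (hf : ∀ l, IsPdf (f l)) (hg : ∀ l, IsPdf (g l))
    {α : PMF (Placement L m)} {E : Placement L m} (h : secondMoment f g α E < ∞) :
    Integrable (fun x => Real.log (mixRatio f g α x).toReal ^ 2) (jointLaw f g E.1) := by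
  have hm := measurable_mixRatio (fun l => (hf l).1) (fun l => (hg l).1) α
  refine ⟨(hm.ennreal_toReal.log.pow_const 2).aestronglyMeasurable, ?_⟩
  rw [hasFiniteIntegral_iff_ofReal (ae_of_all _ fun x => sq_nonneg _)]
  refine lt_of_eq_of_lt (lintegral_congr_ae ?_) h
  filter_upwards [mixRatio_ne_zero_ae_of_secondMoment hf hg h] with x hx
  rw [abs_log_eq_ofReal hx.1 hx.2, ← ENNReal.ofReal_pow (abs_nonneg _), sq_abs]

theorem integrable_log_of_secondMoment (hf : ∀ l, IsPdf (f l)) (hg : ∀ l, IsPdf (g l))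
    {α : PMF (Placement L m)} {E : Placement L m} (h : secondMoment f g α E < ∞) :
    Integrable (fun x => Real.log (mixRatio f g α x).toReal) (jointLaw f g E.1) := by
  have hm := measurable_mixRatio (fun l => (hf l).1) (fun l => (hg l).1) α
  have := isProbabilityMeasure_jointLaw hf hg E.1
  refine ((integrable_const (1 : ℝ)).add (integrable_log_sq_of_secondMoment hf hg h)).mono'
    hm.ennreal_toReal.log.aestronglyMeasurable (ae_of_all _ fun x => ?_)
  rw [Real.norm_eq_abs, Pi.add_apply, ← sq_abs (Real.log _)]
  nlinarith [sq_nonneg (|Real.log (mixRatio f g α x).toReal| - 1),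
    abs_nonneg (Real.log (mixRatio f g α x).toReal)]

/-- The saddle-point property: the minimizing mixture yields drift at least `I` whichever placement
is active. Its ratio mixed with that of `E` is the ratio of `perturb`, again a competitor for the
minimum. -/
theorem klNumber_le_integral_log (hf : ∀ l, IsPdf (f l)) (hg : ∀ l, IsPdf (g l))
    (hI : ∀ α : PMF (Placement L m), klNumber f g α < ∞) {αs : PMF (Placement L m)}
    (hmin : ∀ α : PMF (Placement L m), klNumber f g αs ≤ klNumber f g α)
    {E : Placement L m} (hmom : secondMoment f g αs E < ∞) :
    (klNumber f g αs).toReal ≤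
      ∫ x, Real.log (mixRatio f g αs x).toReal ∂(jointLaw f g E.1) := by
  have hf' := fun l => (hf l).1
  have hg' := fun l => (hg l).1
  have := isProbabilityMeasure_preLaw hg
  have hjoint : jointLaw f g E.1 = (preLaw g).withDensity (mixRatio f g (PMF.pure E)) := by
    rw [jointLaw_eq_withDensity hf' hg' (hI _), mixRatio_pure]
  have hqm := measurable_mixRatio hf' hg' (PMF.pure E)
  have hrm := measurable_mixRatio hf' hg' αs
  have hqtop := mixRatio_ne_top_ae hf hg (hI (PMF.pure E))
  have hrtop := mixRatio_ne_top_ae hf hg (hI αs)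
  have hint := integrable_log_of_secondMoment hf hg hmom
  rw [hjoint, integrable_withDensity_iff_integrable_smul' hqm (hqtop.mono fun x hx => hx.lt_top)]
    at hint
  rw [hjoint, integral_withDensity_eq_integral_toReal_smul hqm
    (hqtop.mono fun x hx => hx.lt_top), ← integral_mixRatio_mul_log hf hg (hI αs)]
  refine integral_mul_log_le_of_forall_mix hrm.ennreal_toReal hqm.ennreal_toReal
    (fun _ => ENNReal.toReal_nonneg) (fun _ => ENNReal.toReal_nonneg)
    (integrable_mixRatio hf hg (hI _)) (integrable_mixRatio hf hg (hI _))
    ((integral_mixRatio hf hg (hI _)).trans (integral_mixRatio hf hg (hI _)).symm)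
    (integrable_mixRatio_mul_log hf hg (hI _)) (integrable_mixRatio_mul_log hf hg (hI _))
    hint ?_ fun ε h0 h1 => ?_
  · have h := mixRatio_ne_zero_ae_of_secondMoment hf hg hmom
    rw [hjoint, ae_withDensity_iff hqm] at h
    filter_upwards [h] with x hx hr
    by_contra hq
    have h2 := hx fun h => hq (by simp [h])
    exact (ENNReal.toReal_pos h2.1 h2.2).ne' hr
  · have hε : ENNReal.ofReal ε ≤ 1 := ENNReal.ofReal_le_one.2 (by linarith)
    set β := perturb αs E (ENNReal.ofReal ε) hε with hβ
    have hae : (fun x => (mixRatio f g β x).toReal * Real.log (mixRatio f g β x).toReal)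
        =ᵐ[preLaw g] fun x => ((1 - ε) * (mixRatio f g αs x).toReal +
          ε * (mixRatio f g (PMF.pure E) x).toReal) * Real.log ((1 - ε) *
          (mixRatio f g αs x).toReal + ε * (mixRatio f g (PMF.pure E) x).toReal) := by
      filter_upwards [hqtop, hrtop] with x hq hr
      have h2 : (mixRatio f g β x).toReal = (1 - ε) * (mixRatio f g αs x).toReal +
          ε * (mixRatio f g (PMF.pure E) x).toReal := by
        rw [hβ, mixRatio_perturb, ENNReal.toReal_add (ENNReal.mul_ne_top (by finiteness) hr)
          (ENNReal.mul_ne_top (by finiteness) hq), ENNReal.toReal_mul, ENNReal.toReal_mul,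
          ENNReal.toReal_sub_of_le hε ENNReal.one_ne_top, ENNReal.toReal_one,
          ENNReal.toReal_ofReal h0.le]
      rw [h2]
    refine ⟨(integrable_mixRatio_mul_log hf hg (hI β)).congr hae, ?_⟩
    rw [← integral_congr_ae hae, integral_mixRatio_mul_log hf hg (hI _),
      integral_mixRatio_mul_log hf hg (hI _)]
    exact ENNReal.toReal_mono (hI _).ne (hmin β)

theorem map_eval_jointLaw (hf : ∀ l, IsPdf (f l)) (hg : ∀ l, IsPdf (g l)) (E : Finset (Fin L))
    (l : Fin L) : (jointLaw f g E).map (fun x => x l) = (volume : Measure ℝ).withDensity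
      fun x => ((if l ∈ E then f l else g l) x : ℝ≥0∞) := by
  rw [jointLaw_eq_pi hf hg]
  have : ∀ l, IsProbabilityMeasure ((volume : Measure ℝ).withDensity
      fun x => ((if l ∈ E then f l else g l) x : ℝ≥0∞)) := fun l =>
    IsPdf.isProbabilityMeasure (by split_ifs; exacts [hf l, hg l])
  exact (measurePreserving_eval (fun l => (volume : Measure ℝ).withDensity
      fun x => ((if l ∈ E then f l else g l) x : ℝ≥0∞)) l).map_eq

theorem map_eval_preLaw (hg : ∀ l, IsPdf (g l)) (l : Fin L) :
    (preLaw g).map (fun x => x l) = (volume : Measure ℝ).withDensity fun x => (g l x : ℝ≥0∞) := by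
  rw [preLaw_eq_pi hg]
  have := fun l => (hg l).isProbabilityMeasure
  exact (measurePreserving_eval (fun l => (volume : Measure ℝ).withDensity
      fun x => (g l x : ℝ≥0∞)) l).map_eq

theorem eq_of_sum_mul_ite_eq {ι : Type*} [Fintype ι] {w : ι → ℝ≥0∞} {p : ι → Prop}
    [DecidablePred p] {i : ι} {a b : ℝ≥0∞} (hw : ∀ i, w i ≠ ∞) (hp : p i) (hwi : w i ≠ 0)
    (hb : b ≠ ∞) (h : ∑ i, w i * (if p i then a else b) = ∑ i, w i * b) : a = b := by
  simp_rw [mul_ite] at h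
  rw [Finset.sum_ite, ← Finset.sum_filter_add_sum_filter_not Finset.univ p fun i => w i * b,
    ENNReal.add_left_inj (ENNReal.sum_ne_top.2 fun i _ => ENNReal.mul_ne_top (hw i) hb),
    ← Finset.sum_mul, ← Finset.sum_mul] at h
  refine (ENNReal.mul_right_inj ?_ (ENNReal.sum_ne_top.2 fun i _ => hw i)).1 h
  exact fun h0 => hwi (Finset.sum_eq_zero_iff.1 h0 i (by simpa using hp))

/-- At a sensor of a placement charged by `α`, the marginal of the mixture gives `f l` positive
weight against `g l`; equality with `g l` would force the two to agree. -/
theorem mixLaw_ne_preLaw (hm : 1 ≤ m) (hf : ∀ l, IsPdf (f l)) (hg : ∀ l, IsPdf (g l))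
    (hfg : ∀ l, ¬ f l =ᵐ[volume] g l) (α : PMF (Placement L m)) :
    mixLaw f g α ≠ preLaw g := by
  intro heq
  obtain ⟨E₀, hE₀⟩ := α.support_nonempty
  obtain ⟨l, hl⟩ : E₀.1.Nonempty := Finset.card_pos.1 (by rw [E₀.2]; omega)
  have := fun l => (hf l).isProbabilityMeasure
  have := fun l => (hg l).isProbabilityMeasure
  set F := (volume : Measure ℝ).withDensity fun x => (f l x : ℝ≥0∞) with hF
  set H := (volume : Measure ℝ).withDensity fun x => (g l x : ℝ≥0∞) with hH
  have hFH : F = H := by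
    ext s hs
    have hjs : ∀ E : Placement L m, jointLaw f g E.1 ((fun x => x l) ⁻¹' s) =
        if l ∈ E.1 then F s else H s := fun E => by
      rw [← Measure.map_apply (measurable_pi_apply l) hs, map_eval_jointLaw hf hg]
      split_ifs <;> rfl
    have h1 : ∑ E : Placement L m, α E * (if l ∈ E.1 then F s else H s) = H s := by
      have h2 := congrArg (fun μ : Measure (Fin L → ℝ) => μ ((fun x => x l) ⁻¹' s)) heq
      beta_reduce at h2
      rw [mixLaw_eq_sum (fun l => (hf l).1) fun l => (hg l).1,
        ← Measure.map_apply (μ := preLaw g) (measurable_pi_apply l) hs, map_eval_preLaw hg] at h2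
      simpa only [Measure.coe_finsetSum, Finset.sum_apply, Measure.smul_apply, smul_eq_mul,
        hjs] using h2
    have h3 : ∑ E : Placement L m, α E * H s = H s := by
      rw [← Finset.sum_mul, ← tsum_fintype (L := .unconditional _), α.tsum_coe, one_mul]
    exact eq_of_sum_mul_ite_eq α.apply_ne_top hl ((PMF.mem_support_iff _ _).1 hE₀)
      (measure_ne_top _ _) (h1.trans h3.symm)
  have hae := (withDensity_eq_iff (hf l).1.coe_nnreal_ennreal.aemeasurable
    (hg l).1.coe_nnreal_ennreal.aemeasurable (by rw [(hf l).2]; exact ENNReal.one_ne_top)).1 hFH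
  refine hfg l ?_
  filter_upwards [hae] with x hx
  exact ENNReal.coe_injective hx

theorem klNumber_toReal_pos (hm : 1 ≤ m) (hf : ∀ l, IsPdf (f l)) (hg : ∀ l, IsPdf (g l))
    (hfg : ∀ l, ¬ f l =ᵐ[volume] g l) {α : PMF (Placement L m)} (hI : klNumber f g α < ∞) :
    0 < (klNumber f g α).toReal := by
  have := isProbabilityMeasure_preLaw hg
  have := isProbabilityMeasure_mixLaw hf hg α
  refine ENNReal.toReal_pos (fun h => mixLaw_ne_preLaw hm hf hg hfg α ?_) hI.ne
  exact InformationTheory.klDiv_eq_zero_iff.1 h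

end KullbackLeibler

/-! ### Limits of the two bounds -/

section Asymptotic

/-- The choice `c = √b` makes the overshoot `c` negligible against `b` and the drift loss `M / (4 *
c)` vanish. -/
theorem tendsto_upper_div {I M : ℝ} (hI : 0 < I) :
    Tendsto (fun b : ℝ => max 1 ((b + √b) / (I - M / (4 * √b))) / b) atTop (𝓝 (1 / I)) := by
  have hs : Tendsto (fun b : ℝ => (√b)⁻¹) atTop (𝓝 0) :=
    tendsto_inv_atTop_zero.comp Real.tendsto_sqrt_atTop
  have h1 : Tendsto (fun b : ℝ => (1 + (√b)⁻¹) / (I - M / 4 * (√b)⁻¹)) atTop (𝓝 (1 / I)) := by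
    have h := (hs.const_add 1).div ((hs.const_mul (M / 4)).const_sub I) (by simpa using hI.ne')
    rw [mul_zero, sub_zero, add_zero] at h
    exact h
  have h2 : Tendsto (fun b : ℝ => max b⁻¹ ((1 + (√b)⁻¹) / (I - M / 4 * (√b)⁻¹))) atTop
      (𝓝 (1 / I)) := by
    have h := tendsto_inv_atTop_zero.max h1
    rwa [max_eq_right (by positivity)] at h
  refine h2.congr' ?_
  filter_upwards [eventually_gt_atTop 0] with b hb
  rw [← max_div_div_right hb.le]
  congr 1
  · simp
  · have hb' : 0 < √b := Real.sqrt_pos.2 hb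
    rw [div_right_comm]
    congr 1
    · rw [add_div, div_self hb.ne', Real.sqrt_div_self]
    · field_simp

theorem tendsto_log_mul_sq_div :
    Tendsto (fun b : ℝ => Real.log (4 * b ^ 2) / b) atTop (𝓝 0) := by
  have h1 : Tendsto (fun b : ℝ => Real.log b / b) atTop (𝓝 0) :=
    Real.isLittleO_log_id_atTop.tendsto_div_nhds_zero
  have h2 : Tendsto (fun b : ℝ => Real.log 4 / b + 2 * (Real.log b / b)) atTop (𝓝 0) := by
    simpa using (tendsto_const_nhds.div_atTop tendsto_id).add (h1.const_mul 2)
  refine h2.congr' ?_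
  filter_upwards [eventually_gt_atTop 0] with b hb
  rw [Real.log_mul (by norm_num) (by positivity), Real.log_pow]
  push_cast
  ring

theorem tendsto_lower_div {I : ℝ} (hI : 0 < I) :
    Tendsto (fun b : ℝ => (b - Real.log (4 * b ^ 2) - 1) / (I + 1 / b) / b) atTop
      (𝓝 (1 / I)) := by
  have h0 : Tendsto (fun b : ℝ => 1 / b) atTop (𝓝 0) := tendsto_const_nhds.div_atTop tendsto_id
  have h1 := ((tendsto_log_mul_sq_div.const_sub 1).sub h0).div (h0.const_add I)
    (by simpa using hI.ne')
  rw [sub_zero, sub_zero, add_zero] at h1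
  refine h1.congr' ?_
  filter_upwards [eventually_gt_atTop 0] with b hb
  rw [div_right_comm _ _ b]
  simp only [Pi.div_apply]
  congr 1
  rw [sub_div, sub_div, div_self hb.ne']

theorem isEquivalent_of_sandwich {V U : ℝ → ℝ≥0∞} {l u : ℝ → ℝ} {I : ℝ} (hI : 0 < I)
    (hl : Tendsto (fun b => l b / b) atTop (𝓝 (1 / I)))
    (hu : Tendsto (fun b => u b / b) atTop (𝓝 (1 / I)))
    (h : ∀ᶠ γ in atTop, ENNReal.ofReal (l (Real.log γ)) ≤ V γ ∧ V γ ≤ U γ ∧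
      U γ ≤ ENNReal.ofReal (u (Real.log γ))) :
    (∀ᶠ γ in atTop, V γ < ∞ ∧ U γ < ∞) ∧
    (fun γ => (V γ).toReal) ~[atTop] (fun γ => (U γ).toReal) ∧
    (fun γ => (U γ).toReal) ~[atTop] (fun γ => Real.log γ / I) := by
  have hfin : ∀ᶠ γ in atTop, V γ < ∞ ∧ U γ < ∞ := h.mono fun γ hγ =>
    have := lt_of_le_of_lt hγ.2.2 ENNReal.ofReal_lt_top
    ⟨lt_of_le_of_lt hγ.2.1 this, this⟩
  have hl' := hl.comp Real.tendsto_log_atTop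
  have hu' := hu.comp Real.tendsto_log_atTop
  have hlog : ∀ᶠ γ in atTop, 0 < Real.log γ := Real.tendsto_log_atTop.eventually_gt_atTop 0
  have hpos : 0 < 1 / I := by positivity
  have hu0 : ∀ᶠ γ in atTop, 0 < u (Real.log γ) := by
    filter_upwards [hu'.eventually (lt_mem_nhds hpos), hlog] with γ h1 h2
    exact (div_pos_iff_of_pos_right h2).1 h1
  have hreal : ∀ᶠ γ in atTop, l (Real.log γ) / Real.log γ ≤ (V γ).toReal / Real.log γ ∧
      (V γ).toReal / Real.log γ ≤ (U γ).toReal / Real.log γ ∧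
      (U γ).toReal / Real.log γ ≤ u (Real.log γ) / Real.log γ := by
    filter_upwards [h, hfin, hlog, hu0] with γ h1 h2 h3 h4
    refine ⟨div_le_div_of_nonneg_right ?_ h3.le, div_le_div_of_nonneg_right ?_ h3.le,
      div_le_div_of_nonneg_right ?_ h3.le⟩
    · exact (ENNReal.ofReal_le_iff_le_toReal h2.1.ne).1 h1.1
    · exact ENNReal.toReal_mono h2.2.ne h1.2.1
    · exact ENNReal.toReal_le_of_le_ofReal h4.le h1.2.2
  have hU : Tendsto (fun γ => (U γ).toReal / Real.log γ) atTop (𝓝 (1 / I)) :=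
    tendsto_of_tendsto_of_tendsto_of_le_of_le' hl' hu'
      (hreal.mono fun γ h => h.1.trans h.2.1) (hreal.mono fun γ h => h.2.2)
  have hV : Tendsto (fun γ => (V γ).toReal / Real.log γ) atTop (𝓝 (1 / I)) :=
    tendsto_of_tendsto_of_tendsto_of_le_of_le' hl' hu'
      (hreal.mono fun γ h => h.1) (hreal.mono fun γ h => h.2.1.trans h.2.2)
  have hequiv : ∀ W : ℝ → ℝ≥0∞,
      Tendsto (fun γ => (W γ).toReal / Real.log γ) atTop (𝓝 (1 / I)) →
      (fun γ => (W γ).toReal) ~[atTop] (fun γ => Real.log γ / I) := fun W hW => by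
    refine (isEquivalent_iff_tendsto_one (hlog.mono fun γ h => (div_pos h hI).ne')).2 ?_
    have h1 := hW.mul_const I
    rw [one_div_mul_cancel hI.ne'] at h1
    refine h1.congr fun γ => ?_
    rw [Pi.div_apply, div_div_eq_mul_div, div_mul_eq_mul_div]
  exact ⟨hfin, (hequiv V hV).trans (hequiv U hU).symm, hequiv U hU⟩

end Asymptotic

/-! ### The lower bound with an explicit window -/

section Delay

variable {L m : ℕ} {f g : Fin L → ℝ → ℝ≥0}

theorem ofReal_le_optWadd (hf : ∀ l, IsPdf (f l)) (hg : ∀ l, IsPdf (g l))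
    (hI : ∀ α : PMF (Placement L m), klNumber f g α < ∞) (α : PMF (Placement L m)) {b : ℝ}
    (hb : 1 ≤ b) (hb2 : 4 * b ^ 2 ≤ Real.exp b) :
    ENNReal.ofReal ((b - Real.log (4 * b ^ 2) - 1) / ((klNumber f g α).toReal + 1 / b)) ≤
      optWadd m f g (Real.exp b) := by
  refine le_iInf₂ fun τ hτ => ?_
  by_cases htop : wadd m f g τ = ∞
  · rw [htop]; exact le_top
  have hI0 : 0 ≤ (klNumber f g α).toReal := ENNReal.toReal_nonneg
  have hb0 : 0 < b := by linarith
  have hb1 : 1 ≤ b ^ 2 := by nlinarith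
  -- A window of order `b ^ 2` costs only `log (2 * h) = O(log b)` in information, yet is long
  -- enough that the survival term `(b - log (2 * h)) / h` is at most `1 / b`.
  set h := ⌈b ^ 2⌉₊ with hh
  have h1 : b ^ 2 ≤ h := Nat.le_ceil _
  have h2 : (h : ℝ) ≤ 2 * b ^ 2 := by linarith [Nat.ceil_lt_add_one (by positivity : 0 ≤ b ^ 2)]
  have hh1 : 1 ≤ h := by exact_mod_cast hb1.trans h1
  have hmain := log_sub_one_le_wadd_mul hf hg hI α (mixRatio_ne_top_ae hf hg (hI α))
    (integrable_mixRatio hf hg (hI α)) (integral_mixRatio hf hg (hI α))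
    (integrable_mixRatio_mul_log hf hg (hI α)) (integral_mixRatio_mul_log hf hg (hI α)) hI0 hτ htop
    hh1 (by linarith)
  have hh0 : (0 : ℝ) < h := by linarith
  rw [Real.log_div (Real.exp_pos b).ne' (by positivity), Real.log_exp] at hmain
  have h3 : Real.log (2 * h) ≤ Real.log (4 * b ^ 2) :=
    Real.log_le_log (by positivity) (by linarith)
  have h4 : 0 ≤ Real.log (2 * h) := Real.log_nonneg (by linarith)
  have h5 : (b - Real.log (2 * h)) / h ≤ 1 / b := by
    rw [div_le_div_iff₀ hh0 hb0]
    nlinarith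
  refine (ENNReal.ofReal_le_iff_le_toReal htop).2 ?_
  rw [div_le_iff₀ (by positivity)]
  have h6 := mul_le_mul_of_nonneg_left (add_le_add_right h5 (klNumber f g α).toReal)
    (ENNReal.toReal_nonneg (a := wadd m f g τ))
  linarith

end Delay

end MovingAnomaly

theorem theorem5 {L m : ℕ} (hm : 1 ≤ m) (hmL : m ≤ L)
    (f g : Fin L → ℝ → ℝ≥0) (hf : ∀ l, IsPdf (f l)) (hg : ∀ l, IsPdf (g l))
    (hfg : ∀ l, ¬ f l =ᵐ[volume] g l)
    (hI : ∀ α : PMF (Placement L m), klNumber f g α < ∞)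
    (αs : PMF (Placement L m))
    (hmin : ∀ α : PMF (Placement L m), klNumber f g αs ≤ klNumber f g α)
    (hmom : ∀ E : Placement L m, secondMoment f g αs E < ∞) :
    (∀ γ : ℝ, 1 < γ →
      ENNReal.ofReal γ ≤ mtfa g (mCusumTime f g αs (Real.log γ))) ∧
    (∀ᶠ γ : ℝ in atTop,
      optWadd m f g γ < ∞ ∧ wadd m f g (mCusumTime f g αs (Real.log γ)) < ∞) ∧
    (fun γ : ℝ => (optWadd m f g γ).toReal) ~[atTop]
      (fun γ : ℝ => (wadd m f g (mCusumTime f g αs (Real.log γ))).toReal) ∧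
    (fun γ : ℝ => (wadd m f g (mCusumTime f g αs (Real.log γ))).toReal) ~[atTop]
      (fun γ : ℝ => Real.log γ / (klNumber f g αs).toReal) := by
  have hfa : ∀ γ : ℝ, 0 < γ →
      ENNReal.ofReal γ ≤ mtfa g (mCusumTime f g αs (Real.log γ)) := fun γ hγ => by
    have h := ofReal_exp_le_mtfa_mCusumTime (b := Real.log γ) hf hg (hI αs)
    rwa [Real.exp_log hγ] at h
  refine ⟨fun γ hγ => hfa γ (by linarith), ?_⟩
  have hpos := klNumber_toReal_pos hm hf hg hfg (hI αs)
  set I := (klNumber f g αs).toReal with hIdef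
  -- Any common bound for the second moments will do; the sum over the finitely many placements is
  -- convenient.
  set M := ∑ E : Placement L m,
    ∫ x, Real.log (mixRatio f g αs x).toReal ^ 2 ∂(jointLaw f g E.1) with hM
  refine isEquivalent_of_sandwich hpos (tendsto_lower_div hpos) (tendsto_upper_div (M := M) hpos) ?_
  have e1 : ∀ᶠ b : ℝ in atTop, 4 * b ^ 2 ≤ Real.exp b := by
    have h := (Real.isLittleO_pow_exp_atTop (n := 2)).def (show (0 : ℝ) < 1 / 4 by norm_num)
    filter_upwards [h] with b hb
    rw [Real.norm_of_nonneg (sq_nonneg b), Real.norm_of_nonneg (Real.exp_pos b).le] at hb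
    linarith
  have e2 : ∀ᶠ b : ℝ in atTop, 0 < I - M / (4 * √b) := by
    have h : Tendsto (fun b : ℝ => I - M / (4 * √b)) atTop (𝓝 (I - 0)) :=
      (tendsto_const_nhds.div_atTop (Real.tendsto_sqrt_atTop.const_mul_atTop four_pos)).const_sub I
    rw [sub_zero] at h
    exact h.eventually (lt_mem_nhds hpos)
  filter_upwards [Real.tendsto_log_atTop.eventually e1, Real.tendsto_log_atTop.eventually e2,
    Real.tendsto_log_atTop.eventually_ge_atTop 1, eventually_gt_atTop 0] with γ h1 h2 h3 hγ
  refine ⟨?_, ?_, ?_⟩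
  · have h := ofReal_le_optWadd hf hg hI αs h3 h1
    rwa [Real.exp_log hγ] at h
  · exact iInf₂_le _ ⟨isDetectionTime_mCusumTime (fun l => (hf l).1) (fun l => (hg l).1), hfa γ hγ⟩
  · rw [ENNReal.ofReal_max, ENNReal.ofReal_one]
    refine wadd_mCusumTime_le hf hg (by linarith) (Real.sqrt_pos.2 (by linarith))
      (fun E => mixRatio_ne_zero_ae_of_secondMoment hf hg (hmom E))
      (fun E => integrable_log_of_secondMoment hf hg (hmom E))
      (fun E => integrable_log_sq_of_secondMoment hf hg (hmom E))
      (fun E => klNumber_le_integral_log hf hg hI hmin (hmom E)) (fun E => ?_) h2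
    exact Finset.single_le_sum (f := fun E : Placement L m =>
      ∫ x, Real.log (mixRatio f g αs x).toReal ^ 2 ∂(jointLaw f g E.1))
      (fun E _ => integral_nonneg fun x => sq_nonneg _) (Finset.mem_univ E)
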